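/- Let $(\Omega,\mathcal F_\infty,(\mathcal F_t)_{t\ge 0},P)$ be a filtered probability space satisfying the usual conditions (complete, right-continuous), with $\mathcal F_0$ generated by the $P$-null sets. Stopping times take values in $[0,\infty]$, $\mathcal F_\tau=\{A\in\mathcal F_\infty : A\cap\{\tau\le t\}\in\mathcal F_t\ \forall t\}$, and $L^\infty(\mathcal F_\tau)$ is the space of classes of essentially bounded $\mathcal F_\tau$-measurable functions; (in)equalities in it hold almost surely. A *dynamic pricing procedure* is a family of maps $\Pi_{\sigma,\tau}:L^\infty(\mathcal F_\tau)\to L^\infty(\mathcal F_\sigma)$, for stopping times $\sigma\le\tau$, that are monotone, translation invariant ($\Pi_{\sigma,\tau}(X+Z)=\Pi_{\sigma,\tau}(X)+Z$ for $Z\in L^\infty(\mathcal F_\sigma)$), convex, and normalized ($\Pi_{\sigma,\tau}(0)=0$). The ask price of $X$ is $\Pi_{\sigma,\tau}(X)$ and its bid price is $-\Pi_{\sigma,\tau}(-X)$. It is a *TCPP* if it is time consistent ($\Pi_{\nu,\sigma}(\Pi_{\sigma,\tau}(X))=\Pi_{\nu,\tau}(X)$ for $\nu\le\sigma\le\tau$)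 and continuous from below ($X_n\uparrow X$ a.s. in $L^\infty(\mathcal F_\tau)$ implies $\Pi_{\sigma,\tau}(X_n)\to\Pi_{\sigma,\tau}(X)$ a.s.). It has *No Free Lunch* if $\overline{\mathcal C}\cap L^\infty_+(\mathcal F_\infty)=\{0\}$, where $\overline{\mathcal C}$ is the $\sigma(L^\infty(P),L^1(P))$-closure of $\mathcal C=\{\lambda X:\lambda\ge 0,\ X\in L^\infty(\mathcal F_\infty),\ \Pi_{0,\infty}(X)\le 0\}$. Let $S=(S^k)_{0\le k\le d}$ be real-valued adapted processes with $S^0\equiv1$ and $S^k$ locally bounded for $1\le k\le d$. Below, "$S^k_\tau\in L^\infty(\mathcal F_\tau)$" includes that $\tau<\infty$ almost surely. A TCPP *extends the dynamics of $S$* if $\Pi_{\sigma,\tau}(nS^k_\tau)=nS^k_\sigma$ for all $k$, all $n\in\mathbb Z$, and all stopping times $\sigma\le\tau$ with $S^k_\tau\in L^\infty(\mathcal F_\tau)$. Let $\mathcal M^e$ be the set of *equivalent local martingale measures*, i.e. of the probability measures $Q\sim P$ such that $E_Q(S^k_\tau\mid\mathcal F_\sigma)=S^k_\sigma$ a.s.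 for all $k$ and all stopping times $\sigma\le\tau$ with $S^k_\tau\in L^\infty(\mathcal F_\tau)$. **Statement.** Let $(\Pi_{\sigma,\tau})$ be a No Free Lunch TCPP extending the dynamics of $S$. Then $\mathcal M^e\neq\emptyset$, and for all stopping times $\sigma\le\tau$ and all $X\in L^\infty(\mathcal F_\tau)$, almost surely, $$\operatorname*{ess\,inf}_{Q\in\mathcal M^e}E_Q(X\mid\mathcal F_\sigma)\ \le\ -\Pi_{\sigma,\tau}(-X)\ \le\ \Pi_{\sigma,\tau}(X)\ \le\ \operatorname*{ess\,sup}_{Q\in\mathcal M^e}E_Q(X\mid\mathcal F_\sigma).$$ In particular, at time $\sigma=0$, the bid and ask prices lie within the sub- and super-replication prices: $$\inf_{Q\in\mathcal M^e}E_Q(X)\ \le\ -\Pi_{0,\tau}(-X)\ \le\ \Pi_{0,\tau}(X)\ \le\ \sup_{Q\in\mathcal M^e}E_Q(X).$$ -/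

import Mathlib

open MeasureTheory ProbabilityTheory Filter Topology
open scoped NNReal ENNReal

noncomputable section

namespace BidAsk

variable {Ω : Type*} {m : MeasurableSpace Ω}

/-- The standing assumptions on the filtered probability space `(Ω, 𝓕_∞, (𝓕_t)_{t ≥ 0}, P)`,
where `𝓕_∞` is the ambient sigma-algebra `m`: the probability space is complete, the filtration
is right-continuous, and `𝓕_0` is the sigma-algebra generated by the `P`-null sets of `𝓕_∞`
(so that every `𝓕_t` contains all the null sets). -/
structure UsualConditions (𝓕 : Filtration ℝ≥0 m) (P : Measure Ω) : Prop where
  complete : P.IsComplete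
  rightContinuous : 𝓕.IsRightContinuous
  initial : 𝓕 0 = MeasurableSpace.generateFrom {A : Set Ω | MeasurableSet[m] A ∧ P A = 0}

/-- The stopping times of the filtration `𝓕`, with values in `[0, ∞]`, ordered pointwise. -/
abbrev StopTime (𝓕 : Filtration ℝ≥0 m) : Type _ :=
  {τ : Ω → WithTop ℝ≥0 // IsStoppingTime 𝓕 τ}

variable {𝓕 : Filtration ℝ≥0 m}

/-- The stopping time `0`. -/
def StopTime.zero (𝓕 : Filtration ℝ≥0 m) : StopTime 𝓕 :=
  ⟨fun _ => ((0 : ℝ≥0) : WithTop ℝ≥0), isStoppingTime_const 𝓕 0⟩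

/-- The stopping time `∞`. -/
def StopTime.infty (𝓕 : Filtration ℝ≥0 m) : StopTime 𝓕 :=
  ⟨fun _ => ⊤, fun i => by simp⟩

theorem StopTime.zero_le (τ : StopTime 𝓕) : StopTime.zero 𝓕 ≤ τ := by
  intro ω
  change ((0 : ℝ≥0) : WithTop ℝ≥0) ≤ τ.1 ω
  exact bot_le

theorem StopTime.le_infty (τ : StopTime 𝓕) : τ ≤ StopTime.infty 𝓕 := fun _ => le_top

/-- `𝓕_τ = {A ∈ 𝓕_∞ | ∀ t, A ∩ {τ ≤ t} ∈ 𝓕_t}`, where `𝓕_∞` is the ambient sigma-algebra `m`.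
(If `m` is generated by the `𝓕_t`, this is `MeasureTheory.IsStoppingTime.measurableSpace`.) -/
@[reducible]
def StopTime.sigma (τ : StopTime 𝓕) : MeasurableSpace Ω where
  MeasurableSet' A := MeasurableSet[m] A ∧ ∀ t : ℝ≥0, MeasurableSet[𝓕 t] (A ∩ {ω | τ.1 ω ≤ t})
  measurableSet_empty := by simp
  measurableSet_compl A hA := by
    refine ⟨hA.1.compl, fun t => ?_⟩
    have h : Aᶜ ∩ {ω | τ.1 ω ≤ t} = {ω | τ.1 ω ≤ t} \ (A ∩ {ω | τ.1 ω ≤ t}) := by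
      ext ω
      simp only [Set.mem_inter_iff, Set.mem_compl_iff, Set.mem_sdiff]
      tauto
    rw [h]
    exact (τ.2 t).diff (hA.2 t)
  measurableSet_iUnion A hA := by
    refine ⟨MeasurableSet.iUnion fun i => (hA i).1, fun t => ?_⟩
    rw [Set.iUnion_inter]
    exact MeasurableSet.iUnion fun i => (hA i).2 t

theorem StopTime.sigma_eq_measurableSpace (τ : StopTime 𝓕) (hm : m = ⨆ t, 𝓕 t) :
    τ.sigma = τ.2.measurableSpace := by
  ext A
  change (MeasurableSet[m] A ∧ _) ↔ (MeasurableSet[⨆ t, 𝓕 t] A ∧ _)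
  rw [← hm]

theorem StopTime.sigma_mono {σ τ : StopTime 𝓕} (h : σ ≤ τ) : σ.sigma ≤ τ.sigma := by
  intro A hA
  refine ⟨hA.1, fun t => ?_⟩
  have h' : A ∩ {ω | τ.1 ω ≤ t} = (A ∩ {ω | σ.1 ω ≤ t}) ∩ {ω | τ.1 ω ≤ t} := by
    ext ω
    simp only [Set.mem_inter_iff, Set.mem_ofPred_eq]
    exact ⟨fun hω => ⟨⟨hω.1, (h ω).trans hω.2⟩, hω.2⟩, fun hω => ⟨hω.1.1, hω.2⟩⟩
  rw [h']
  exact (hA.2 t).inter (τ.2 t)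

/-- `L^∞(Ω, 𝓕_τ, P)`, realised as the subspace of those classes in `L^∞(Ω, 𝓕_∞, P)` that have an
`𝓕_τ`-measurable representative. -/
abbrev Linf (P : Measure Ω) (τ : StopTime 𝓕) : Submodule ℝ (Lp ℝ ∞ P) :=
  lpMeas ℝ ℝ τ.sigma ∞ P

theorem Linf_mono (P : Measure Ω) {σ τ : StopTime 𝓕} (h : σ ≤ τ) : Linf P σ ≤ Linf P τ := by
  intro X hX
  rw [mem_lpMeas_iff_aestronglyMeasurable] at hX ⊢
  exact hX.mono (StopTime.sigma_mono h)

/-- The inclusion `L^∞(𝓕_σ) ⊆ L^∞(𝓕_τ)` for `σ ≤ τ`. -/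
abbrev Linf.incl {P : Measure Ω} {σ τ : StopTime 𝓕} (h : σ ≤ τ) (Z : Linf P σ) : Linf P τ :=
  Submodule.inclusion (Linf_mono P h) Z

/-- A dynamic pricing procedure: a family of maps `Π_{σ,τ} : L^∞(𝓕_τ) → L^∞(𝓕_σ)`, for stopping
times `σ ≤ τ`, that are monotone, translation invariant, convex and normalized.
`Π_{σ,τ}(X)` is the ask price of `X`, and `-Π_{σ,τ}(-X)` its bid price. -/
structure PricingProcedure (𝓕 : Filtration ℝ≥0 m) (P : Measure Ω) where
  price : ∀ {σ τ : StopTime 𝓕}, σ ≤ τ → Linf P τ → Linf P σ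
  monotone : ∀ {σ τ : StopTime 𝓕} (h : σ ≤ τ) (X Y : Linf P τ),
    X ≤ Y → price h X ≤ price h Y
  translation : ∀ {σ τ : StopTime 𝓕} (h : σ ≤ τ) (Z : Linf P σ) (X : Linf P τ),
    price h (X + Linf.incl h Z) = price h X + Z
  convex : ∀ {σ τ : StopTime 𝓕} (h : σ ≤ τ) (X Y : Linf P τ) (r : ℝ), 0 ≤ r → r ≤ 1 →
    price h (r • X + (1 - r) • Y) ≤ r • price h X + (1 - r) • price h Y
  normalized : ∀ {σ τ : StopTime 𝓕} (h : σ ≤ τ), price h 0 = 0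

namespace PricingProcedure

variable {P : Measure Ω}

/-- `Π_{ν,σ}(Π_{σ,τ}(X)) = Π_{ν,τ}(X)` for all stopping times `ν ≤ σ ≤ τ`. -/
def TimeConsistent (Pi : PricingProcedure 𝓕 P) : Prop :=
  ∀ ⦃ν σ τ : StopTime 𝓕⦄ (h₁ : ν ≤ σ) (h₂ : σ ≤ τ) (X : Linf P τ),
    Pi.price h₁ (Pi.price h₂ X) = Pi.price (h₁.trans h₂) X

/-- If `X_n` increases to `X` (almost surely, all in `L^∞(𝓕_τ)`), then `Π_{σ,τ}(X_n)` converges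
to `Π_{σ,τ}(X)` almost surely. -/
def ContinuousFromBelow (Pi : PricingProcedure 𝓕 P) : Prop :=
  ∀ ⦃σ τ : StopTime 𝓕⦄ (h : σ ≤ τ) (X : ℕ → Linf P τ) (Y : Linf P τ), Monotone X →
    (∀ᵐ ω ∂P, Tendsto (fun n => (X n : Lp ℝ ∞ P) ω) atTop (𝓝 ((Y : Lp ℝ ∞ P) ω))) →
    ∀ᵐ ω ∂P, Tendsto (fun n => (Pi.price h (X n) : Lp ℝ ∞ P) ω) atTop
      (𝓝 ((Pi.price h Y : Lp ℝ ∞ P) ω))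

/-- A TCPP: a time-consistent dynamic pricing procedure that is continuous from below. -/
structure IsTCPP (Pi : PricingProcedure 𝓕 P) : Prop where
  timeConsistent : Pi.TimeConsistent
  continuousFromBelow : Pi.ContinuousFromBelow

/-- The cone `{r X | r ≥ 0, X ∈ L^∞(𝓕_∞), Π_{0,∞}(X) ≤ 0}`. -/
def zeroCostCone (Pi : PricingProcedure 𝓕 P) : Set (Lp ℝ ∞ P) :=
  {Y | ∃ (r : ℝ) (X : Linf P (StopTime.infty 𝓕)), 0 ≤ r ∧
    Pi.price (StopTime.zero_le (StopTime.infty 𝓕)) X ≤ 0 ∧ Y = r • (X : Lp ℝ ∞ P)}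

end PricingProcedure

/-- The weak-star topology `σ(L^∞(P), L^1(P))`: the coarsest topology on `L^∞(P)` for which
`X ↦ E_P(X g)` is continuous for every `g ∈ L^1(P)`. -/
@[reducible]
def weakStarTopology (P : Measure Ω) : TopologicalSpace (Lp ℝ ∞ P) :=
  TopologicalSpace.induced (fun (X : Lp ℝ ∞ P) (g : Lp ℝ 1 P) => ∫ ω, X ω * g ω ∂P) inferInstance

/-- No (static) free lunch: the weak-star closure of the cone generated by the positions available
at a nonpositive price contains no nonnegative element other than `0`. -/
def PricingProcedure.NoFreeLunch {P : Measure Ω} (Pi : PricingProcedure 𝓕 P) : Prop :=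
  @closure _ (weakStarTopology P) Pi.zeroCostCone ∩ {X : Lp ℝ ∞ P | 0 ≤ X} = {0}

/-- `S_τ` is meaningful and belongs to `L^∞(𝓕_τ)`: `τ` is almost surely finite (the process has no
value at time `∞`), and `S_τ` is almost surely equal to an element of `L^∞(𝓕_τ)`. -/
def IsBoundedAt (P : Measure Ω) (S : ℝ≥0 → Ω → ℝ) (τ : StopTime 𝓕) : Prop :=
  (∀ᵐ ω ∂P, τ.1 ω ≠ ⊤) ∧ ∃ Y : Linf P τ, (Y : Lp ℝ ∞ P) =ᵐ[P] stoppedValue S τ.1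

/-- Local boundedness: there are stopping times `τ_n` increasing to `∞` such that each stopped
process `S^{τ_n}` is uniformly bounded (its values are the `S_t` with `t ≤ τ_n`). -/
def LocallyBounded (𝓕 : Filtration ℝ≥0 m) (P : Measure Ω) (S : ℝ≥0 → Ω → ℝ) : Prop :=
  ∃ τ : ℕ → Ω → WithTop ℝ≥0, IsLocalizingSequence 𝓕 τ P ∧
    ∀ n, ∃ C : ℝ, ∀ᵐ ω ∂P, ∀ t : ℝ≥0, (t : WithTop ℝ≥0) ≤ τ n ω → |S t ω| ≤ C

variable {d : ℕ}

/-- The reference assets: `S^0 = 1` is the numéraire, the `S^k` are adapted and, for `k ≥ 1`,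
locally bounded. -/
structure IsMarket (𝓕 : Filtration ℝ≥0 m) (P : Measure Ω)
    (S : Fin (d + 1) → ℝ≥0 → Ω → ℝ) : Prop where
  numeraire : ∀ t ω, S 0 t ω = 1
  adapted : ∀ k, StronglyAdapted 𝓕 (S k)
  locallyBounded : ∀ k, k ≠ 0 → LocallyBounded 𝓕 P (S k)

/-- The procedure extends the dynamics of `S`: `Π_{σ,τ}(n S^k_τ) = n S^k_σ` for all `k`, all
integers `n`, and all stopping times `σ ≤ τ` such that `S^k_τ ∈ L^∞(𝓕_τ)`. -/
def PricingProcedure.ExtendsDynamics {P : Measure Ω} (Pi : PricingProcedure 𝓕 P)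
    (S : Fin (d + 1) → ℝ≥0 → Ω → ℝ) : Prop :=
  ∀ (k : Fin (d + 1)) (n : ℤ) ⦃σ τ : StopTime 𝓕⦄ (h : σ ≤ τ), IsBoundedAt P (S k) τ →
    ∀ Y : Linf P τ, (Y : Lp ℝ ∞ P) =ᵐ[P] (fun ω => (n : ℝ) * stoppedValue (S k) τ.1 ω) →
      (Pi.price h Y : Lp ℝ ∞ P) =ᵐ[P] fun ω => (n : ℝ) * stoppedValue (S k) σ.1 ω

/-- The set `M^e` of equivalent local martingale measures for `S`: the probability measures `Q` on
`𝓕_∞`, equivalent to `P`, such that `E_Q(S^k_τ | 𝓕_σ) = S^k_σ` for all `k` and all stopping times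
`σ ≤ τ` such that `S^k_τ ∈ L^∞(𝓕_τ)`. -/
def ELMM (𝓕 : Filtration ℝ≥0 m) (P : Measure Ω) (S : Fin (d + 1) → ℝ≥0 → Ω → ℝ) :
    Set (Measure Ω) :=
  {Q | IsProbabilityMeasure Q ∧ Q ≪ P ∧ P ≪ Q ∧
    ∀ (k : Fin (d + 1)) (σ τ : StopTime 𝓕), σ ≤ τ → IsBoundedAt P (S k) τ →
      condExp σ.sigma Q (stoppedValue (S k) τ.1) =ᵐ[Q] stoppedValue (S k) σ.1}

/-- The set of the conditional expectations `E_Q(X | 𝓕_σ)`, `Q ∈ M^e`, in `L^∞(P)`. Its supremum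
and infimum for the almost sure order of `L^∞(P)` are the essential supremum and infimum. -/
def condPrices (P : Measure Ω) (S : Fin (d + 1) → ℝ≥0 → Ω → ℝ) (σ : StopTime 𝓕)
    (X : Lp ℝ ∞ P) : Set (Lp ℝ ∞ P) :=
  {Y | ∃ Q ∈ ELMM 𝓕 P S, Y =ᵐ[P] condExp σ.sigma Q X}

end BidAsk

end

/-! Write `ρ` for the time-`0` price. Since `𝓕_0` is trivial, it is a real-valued convex functional
on `L^∞`. Define the penalty of `Q ≪ P` to be the supremum over `Y` of `E_Q(Y) - ρ(Y)`; it is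
nonnegative because `ρ(0) = 0`. Four facts carry the proof.

Representation (`IsConvexPrice.exists_measure`): for every `X` and `ε > 0` some `Q ≪ P` has finite
penalty and `ρ(X) ≤ E_Q(X) + ε`. Hahn-Banach yields an `ε`-subgradient of `ρ` at `X`; the work is to
make it countably additive. To this end, continuity from below is used to find a convex set `V`,
defined by bounds on the excesses `E((D - k)^+)`, on which `ρ(X - D)` stays above `ρ(X) - ε` and
which contains large multiples of the indicators of all sufficiently small events.

Kreps-Yan (`exists_equivalent_measure`): No Free Lunch yields `Q₀ ~ P` that is nonpositive on the
zero-cost cone. As `Y - ρ(Y)` costs zero, `Q₀` has penalty zero.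

Finite penalty implies martingale measure (`mem_ELMM_of_integral_le`): for `A ∈ 𝓕_σ` and every
integer `n`, the position `n 1_A (S_τ - S_σ)` costs zero by locality and time consistency, so `n
E_Q(1_A (S_τ - S_σ))` is bounded by the penalty for all `n`, and the expectation vanishes.

Mixing: `(1 - t) Q + t Q₀` is equivalent to `P` with finite penalty, hence lies in `M^e`. Letting `t
→ 0` gives `ρ(X) ≤ sup E_Q(X)` over `M^e`.

For the conditional bound, let `U` be the essential supremum and `A = {U < Π_{σ,τ}(X)}`. The
position `1_A (X - U)` has nonpositive expectation under all of `M^e`, hence nonpositive initial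
price, while its price at `σ` is the positive part of `Π_{σ,τ}(X) - U`. The zero-penalty measure
forces this positive part to vanish. The bid bound is the ask bound for `-X`. -/

namespace BidAsk

/-! ### Bounded sequences in `L^∞`: convergent selections and the Fatou property. -/

section Linfty

variable {Ω : Type*} {m : MeasurableSpace Ω} {P : Measure Ω}

theorem Linfty_exists_bound (X : Lp ℝ ∞ P) : ∃ M : ℝ, 0 ≤ M ∧ ∀ᵐ ω ∂P, |X ω| ≤ M :=
  ⟨‖X‖, norm_nonneg _, by
    have h := ae_le_eLpNormEssSup (f := (X : Ω → ℝ)) (μ := P)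
    filter_upwards [h] with ω hω
    rw [Lp.norm_def, eLpNorm_exponent_top, ← Real.norm_eq_abs, ← toReal_enorm]
    refine ENNReal.toReal_mono ?_ hω
    have := Lp.eLpNorm_ne_top X
    rwa [eLpNorm_exponent_top] at this⟩

theorem exists_Linfty_ae_eq {f : Ω → ℝ} (hf : AEStronglyMeasurable f P) {C : ℝ}
    (hC : ∀ᵐ ω ∂P, |f ω| ≤ C) : ∃ Y : Lp ℝ ∞ P, Y =ᵐ[P] f :=
  ⟨(memLp_top_of_bound hf C hC).toLp f, MemLp.coeFn_toLp _⟩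

theorem Linfty_smul_nonneg {r : ℝ} (hr : 0 ≤ r) {X : Lp ℝ ∞ P} (hX : 0 ≤ X) : 0 ≤ r • X := by
  rw [← Lp.coeFn_nonneg]
  filter_upwards [Lp.coeFn_smul r X, (Lp.coeFn_nonneg X).2 hX] with ω h1 h2
  rw [h1]
  exact mul_nonneg hr h2

theorem Linfty_integrable [IsFiniteMeasure P] (X : Lp ℝ ∞ P) : Integrable X P :=
  (Lp.memLp X).integrable le_top

theorem Linfty_integrable_of_ac {Q : Measure Ω} [IsFiniteMeasure Q] (hQ : Q ≪ P)
    (X : Lp ℝ ∞ P) : Integrable X Q := by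
  obtain ⟨M, -, hM⟩ := Linfty_exists_bound X
  exact Integrable.of_bound ((Lp.aestronglyMeasurable X).mono_ac hQ) M (hQ.ae_le hM)

theorem Linfty_mul_integrable (X : Lp ℝ ∞ P) (g : Lp ℝ 1 P) :
    Integrable (fun ω => X ω * g ω) P := by
  obtain ⟨M, -, hM⟩ := Linfty_exists_bound X
  exact (L1.integrable_coeFn g).bdd_mul (Lp.aestronglyMeasurable X) hM

/-- In a decreasing sequence of nonempty, convex, bounded subsets of an inner product space one
can choose a Cauchy sequence of points. -/
theorem exists_cauchySeq_of_antitone_convex {E : Type*} [NormedAddCommGroup E]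
    [InnerProductSpace ℝ E] (C : ℕ → Set E) (hconv : ∀ n, Convex ℝ (C n))
    (hne : ∀ n, (C n).Nonempty) (hanti : Antitone C) {M : ℝ} (hM : ∀ x ∈ C 0, ‖x‖ ≤ M) :
    ∃ f : ℕ → E, (∀ n, f n ∈ C n) ∧ CauchySeq f := by
  set I : ℕ → ℝ := fun n => sInf ((fun x => ‖x‖ ^ 2) '' C n) with hI
  have hbdd : ∀ n, BddBelow ((fun x => ‖x‖ ^ 2) '' C n) := fun n =>
    ⟨0, by rintro _ ⟨x, -, rfl⟩; positivity⟩
  have hle : ∀ n, ∀ x ∈ C n, I n ≤ ‖x‖ ^ 2 := fun n x hx => csInf_le (hbdd n) ⟨x, hx, rfl⟩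
  have hmono : Monotone I := fun i j hij =>
    csInf_le_csInf (hbdd i) ((hne j).image _) (Set.image_mono (hanti hij))
  have hub : ∀ n, I n ≤ M ^ 2 := fun n => by
    obtain ⟨x, hx⟩ := hne n
    refine (hle n x hx).trans ?_
    have := hM x (hanti (Nat.zero_le n) hx)
    gcongr
  have hconvI : Tendsto I atTop (𝓝 (⨆ n, I n)) :=
    tendsto_atTop_ciSup hmono ⟨M ^ 2, by rintro _ ⟨n, rfl⟩; exact hub n⟩
  have hex : ∀ n : ℕ, ∃ x ∈ C n, ‖x‖ ^ 2 < I n + 1 / ((n : ℝ) + 1) := fun n => by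
    obtain ⟨_, ⟨x, hx, rfl⟩, hlt⟩ := exists_lt_of_csInf_lt ((hne n).image _)
      (show sInf ((fun x => ‖x‖ ^ 2) '' C n) < I n + 1 / ((n : ℝ) + 1) by
        have : (0 : ℝ) < 1 / ((n : ℝ) + 1) := by positivity
        simp only [hI]; linarith)
    exact ⟨x, hx, hlt⟩
  choose f hfC hfI using hex
  refine ⟨f, hfC, ?_⟩
  set L := ⨆ n, I n
  have hIL : ∀ n, I n ≤ L := fun n => le_ciSup (f := I)
    ⟨M ^ 2, by rintro _ ⟨n, rfl⟩; exact hub n⟩ n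
  have key : ∀ N n : ℕ, N ≤ n → ∀ k, N ≤ k → ‖f n - f k‖ ^ 2 ≤
      4 * (L - I N) + 4 * (1 / ((N : ℝ) + 1)) := by
    intro N n hn k hk
    -- The midpoint stays in `C N`, so its squared norm is at least `I N`; as `f n` and `f k` are
    -- nearly minimal, the parallelogram law makes their difference small.
    have hmid : (1 / 2 : ℝ) • f n + (1 / 2 : ℝ) • f k ∈ C N :=
      hconv N (hanti hn (hfC n)) (hanti hk (hfC k)) (by norm_num) (by norm_num) (by norm_num)
    have h1 := hle N _ hmid
    rw [← smul_add, norm_smul, mul_pow] at h1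
    have h2 := parallelogram_law_with_norm ℝ (f n) (f k)
    have h3 := hfI n
    have h4 := hfI k
    have h5 : 1 / ((n : ℝ) + 1) ≤ 1 / ((N : ℝ) + 1) := by gcongr
    have h6 : 1 / ((k : ℝ) + 1) ≤ 1 / ((N : ℝ) + 1) := by gcongr
    have h7 := hIL n
    have h8 := hIL k
    norm_num at h1
    nlinarith
  have hlim : Tendsto (fun N : ℕ => 4 * (L - I N) + 4 * (1 / ((N : ℝ) + 1))) atTop (𝓝 0) := by
    have h1 := (hconvI.const_sub L).const_mul 4
    have h2 := (tendsto_one_div_add_atTop_nhds_zero_nat (𝕜 := ℝ)).const_mul 4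
    simpa using h1.add h2
  rw [Metric.cauchySeq_iff]
  intro ε hε
  obtain ⟨N, hN⟩ := (hlim.eventually (gt_mem_nhds (show (0 : ℝ) < ε ^ 2 by positivity))).exists
  refine ⟨N, fun n hn k hk => ?_⟩
  rw [dist_eq_norm]
  exact lt_of_pow_lt_pow_left₀ 2 hε.le ((key N n hn k hk).trans_lt hN)

/-- In a decreasing sequence of nonempty, convex, uniformly bounded subsets of `L^∞` one can choose
an almost surely convergent sequence. -/
theorem exists_ae_tendsto_of_antitone_convex [IsProbabilityMeasure P] (C : ℕ → Set (Lp ℝ ∞ P))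
    (hconv : ∀ n, Convex ℝ (C n)) (hne : ∀ n, (C n).Nonempty) (hanti : Antitone C) {M : ℝ}
    (hM : ∀ X ∈ C 0, ∀ᵐ ω ∂P, |X ω| ≤ M) :
    ∃ (D : ℕ → Lp ℝ ∞ P) (Y : Lp ℝ ∞ P), (∀ n, D n ∈ C n) ∧
      ∀ᵐ ω ∂P, Tendsto (fun n => D n ω) atTop (𝓝 (Y ω)) := by
  -- The selection is made in the Hilbert space `L^2`; an a.s. convergent subsequence `φ` keeps
  -- membership because `n ≤ φ n` and the sets decrease.
  set K : ℕ → Set (Lp ℝ 2 P) := fun n => {f | ∃ X ∈ C n, f =ᵐ[P] X} with hK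
  have hKconv : ∀ n, Convex ℝ (K n) := by
    rintro n f ⟨X, hX, hfX⟩ g ⟨Y, hY, hgY⟩ a b ha hb hab
    refine ⟨a • X + b • Y, hconv n hX hY ha hb hab, ?_⟩
    filter_upwards [hfX, hgY, Lp.coeFn_add (a • f) (b • g), Lp.coeFn_smul a f, Lp.coeFn_smul b g,
      Lp.coeFn_add (a • X) (b • Y), Lp.coeFn_smul a X, Lp.coeFn_smul b Y]
      with ω h1 h2 h3 h4 h5 h6 h7 h8
    simp only [h1, h2, h3, h4, h5, h6, h7, h8, Pi.add_apply, Pi.smul_apply]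
  have hKne : ∀ n, (K n).Nonempty := fun n => by
    obtain ⟨X, hX⟩ := hne n
    have hX2 : MemLp X 2 P := (Lp.memLp X).mono_exponent le_top
    exact ⟨hX2.toLp X, X, hX, hX2.coeFn_toLp⟩
  have hKanti : Antitone K := by
    rintro i j hij f ⟨X, hX, hfX⟩
    exact ⟨X, hanti hij hX, hfX⟩
  have hM0 : 0 ≤ M := by
    obtain ⟨X, hX⟩ := hne 0
    obtain ⟨ω, hω⟩ := (hM X hX).exists
    exact (abs_nonneg _).trans hω
  have hKM : ∀ f ∈ K 0, ‖f‖ ≤ M := by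
    rintro f ⟨X, hX, hfX⟩
    have h := Lp.norm_le_of_ae_bound (f := f) hM0 (by
      filter_upwards [hfX, hM X hX] with ω h1 h2
      rw [h1]; exact h2)
    simpa [measureUnivNNReal] using h
  obtain ⟨f, hfK, hf⟩ := exists_cauchySeq_of_antitone_convex K hKconv hKne hKanti hKM
  obtain ⟨g, hg⟩ := cauchySeq_tendsto_of_complete hf
  obtain ⟨φ, hφ, hφt⟩ := (tendstoInMeasure_of_tendsto_Lp hg).exists_seq_tendsto_ae
  choose X hX hfX using hfK
  have hXM : ∀ n, ∀ᵐ ω ∂P, |X n ω| ≤ M := fun n => hM _ (hanti (Nat.zero_le n) (hX n))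
  have hlim : ∀ᵐ ω ∂P, Tendsto (fun n => X (φ n) ω) atTop (𝓝 (g ω)) := by
    filter_upwards [hφt, ae_all_iff.2 hfX] with ω h1 h2
    simpa only [h2] using h1
  obtain ⟨Y, hY⟩ := exists_Linfty_ae_eq (Lp.aestronglyMeasurable g) (C := M) (by
    filter_upwards [hlim, ae_all_iff.2 hXM] with ω h1 h2
    exact le_of_tendsto h1.abs (Eventually.of_forall fun n => h2 (φ n)))
  refine ⟨fun n => X (φ n), Y, fun n => hanti hφ.le_apply (hX _), ?_⟩
  filter_upwards [hlim, hY] with ω h1 h2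
  rwa [h2]

/-- A real-valued ask price on `L^∞`: monotone, translation invariant, convex, normalized, and
continuous from below. -/
structure IsConvexPrice (P : Measure Ω) [IsFiniteMeasure P] (ρ : Lp ℝ ∞ P → ℝ) : Prop where
  mono : Monotone ρ
  cash : ∀ X c, ρ (X + Lp.const ∞ P c) = ρ X + c
  convex : ∀ X Y (r : ℝ), 0 ≤ r → r ≤ 1 → ρ (r • X + (1 - r) • Y) ≤ r * ρ X + (1 - r) * ρ Y
  zero : ρ 0 = 0
  below : ∀ (X : ℕ → Lp ℝ ∞ P) (Y : Lp ℝ ∞ P), Monotone X →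
    (∀ᵐ ω ∂P, Tendsto (fun n => X n ω) atTop (𝓝 (Y ω))) →
    Tendsto (fun n => ρ (X n)) atTop (𝓝 (ρ Y))

/-- The Fatou property. -/
theorem IsConvexPrice.le_of_ae_tendsto [IsProbabilityMeasure P] {ρ : Lp ℝ ∞ P → ℝ}
    (hρ : IsConvexPrice P ρ) {X : ℕ → Lp ℝ ∞ P} {Y : Lp ℝ ∞ P} {M c : ℝ}
    (hM : ∀ n, ∀ᵐ ω ∂P, |X n ω| ≤ M)
    (hX : ∀ᵐ ω ∂P, Tendsto (fun n => X n ω) atTop (𝓝 (Y ω))) (hc : ∀ n, ρ (X n) ≤ c) :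
    ρ Y ≤ c := by
  have hbd : ∀ᵐ ω ∂P, ∀ n, |X n ω| ≤ M := ae_all_iff.2 hM
  have hbelow : ∀ᵐ ω ∂P, ∀ n, BddBelow (Set.range fun k => X (n + k) ω) := by
    filter_upwards [hbd] with ω h n
    exact ⟨-M, by rintro _ ⟨k, rfl⟩; exact (abs_le.1 (h _)).1⟩
  have hmeas : ∀ n, AEStronglyMeasurable (fun ω => ⨅ k, X (n + k) ω) P := fun n =>
    (AEMeasurable.iInf fun k => (Lp.aestronglyMeasurable (X (n + k))).aemeasurable
      ).aestronglyMeasurable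
  -- The tail infima increase to `Y` and lie below `X n`, which reduces the claim to monotonicity
  -- and continuity from below.
  have hE : ∀ n, ∃ E : Lp ℝ ∞ P, E =ᵐ[P] fun ω => ⨅ k, X (n + k) ω := fun n =>
    exists_Linfty_ae_eq (hmeas n) (C := M) (by
      filter_upwards [hbd, hbelow] with ω h h'
      rw [abs_le]
      exact ⟨le_ciInf fun k => (abs_le.1 (h _)).1,
        (ciInf_le (h' n) 0).trans (abs_le.1 (h _)).2⟩)
  choose E hE using hE
  have hE' : ∀ᵐ ω ∂P, ∀ n, E n ω = ⨅ k, X (n + k) ω := ae_all_iff.2 hE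
  have hEmono : Monotone E := by
    refine monotone_nat_of_le_succ fun n => ?_
    rw [← Lp.coeFn_le]
    filter_upwards [hE', hbelow] with ω h h'
    rw [h, h]
    refine le_ciInf fun k => ?_
    have := ciInf_le (h' n) (1 + k)
    rwa [← add_assoc] at this
  have hEX : ∀ n, E n ≤ X n := fun n => by
    rw [← Lp.coeFn_le]
    filter_upwards [hE', hbelow] with ω h h'
    rw [h]
    exact ciInf_le (h' n) 0
  have hElim : ∀ᵐ ω ∂P, Tendsto (fun n => E n ω) atTop (𝓝 (Y ω)) := by
    filter_upwards [hE', hbelow, hX] with ω h h' hx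
    refine Metric.tendsto_atTop.2 fun ε hε => ?_
    obtain ⟨N, hN⟩ := Metric.tendsto_atTop.1 hx (ε / 2) (by positivity)
    refine ⟨N, fun n hn => ?_⟩
    rw [h, Real.dist_eq, abs_lt]
    have h1 : Y ω - ε / 2 ≤ ⨅ k, X (n + k) ω := le_ciInf fun k => by
      have := hN (n + k) (by omega)
      rw [Real.dist_eq, abs_lt] at this
      linarith [this.1]
    have h2 := ciInf_le (h' n) 0
    have h3 := hN (n + 0) (by omega)
    rw [Real.dist_eq, abs_lt] at h3
    constructor <;> linarith [h3.2]
  exact le_of_tendsto (hρ.below E Y hEmono hElim)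
    (Eventually.of_forall fun n => (hρ.mono (hEX n)).trans (hc n))

end Linfty

/-! ### Subgradients of a convex price that are small on small events. -/

section Representation

variable {Ω : Type*} {m : MeasurableSpace Ω} {P : Measure Ω}

/-- The expected excess `E((D - k)^+)`. -/
noncomputable def excess (P : Measure Ω) (k : ℝ) (D : Lp ℝ ∞ P) : ℝ := ∫ ω, max (D ω - k) 0 ∂P

theorem excess_nonneg (k : ℝ) (D : Lp ℝ ∞ P) : 0 ≤ excess P k D :=
  integral_nonneg fun _ => le_max_right _ _

variable [IsProbabilityMeasure P]

theorem excess_integrable (k : ℝ) (D : Lp ℝ ∞ P) :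
    Integrable (fun ω => max (D ω - k) 0) P :=
  ((Linfty_integrable D).sub (integrable_const k)).pos_part

theorem excess_convex (k : ℝ) (D E : Lp ℝ ∞ P) {a b : ℝ} (ha : 0 ≤ a) (hb : 0 ≤ b)
    (hab : a + b = 1) : excess P k (a • D + b • E) ≤ a * excess P k D + b * excess P k E := by
  unfold excess
  rw [← integral_const_mul, ← integral_const_mul,
    ← integral_add ((excess_integrable k D).const_mul a) ((excess_integrable k E).const_mul b)]
  refine integral_mono_ae (excess_integrable k _)
    (((excess_integrable k D).const_mul a).add ((excess_integrable k E).const_mul b)) ?_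
  filter_upwards [Lp.coeFn_add (a • D) (b • E), Lp.coeFn_smul a D, Lp.coeFn_smul b E]
    with ω h1 h2 h3
  simp only [h1, h2, h3, Pi.add_apply, Pi.smul_apply, smul_eq_mul]
  have h4 := mul_le_mul_of_nonneg_left (le_max_left (D ω - k) 0) ha
  have h5 := mul_le_mul_of_nonneg_left (le_max_left (E ω - k) 0) hb
  have h6 := mul_nonneg ha (le_max_right (D ω - k) 0)
  have h7 := mul_nonneg hb (le_max_right (E ω - k) 0)
  refine max_le ?_ (by linarith)
  have : k = a * k + b * k := by rw [← add_mul, hab, one_mul]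
  linarith

theorem excess_tendsto (k : ℝ) {D : ℕ → Lp ℝ ∞ P} {Y : Lp ℝ ∞ P} {M : ℝ}
    (hM : ∀ n, ∀ᵐ ω ∂P, |D n ω| ≤ M)
    (hD : ∀ᵐ ω ∂P, Tendsto (fun n => D n ω) atTop (𝓝 (Y ω))) :
    Tendsto (fun n => excess P k (D n)) atTop (𝓝 (excess P k Y)) := by
  refine tendsto_integral_of_dominated_convergence (fun _ => M + |k|)
    (fun n => (excess_integrable k (D n)).aestronglyMeasurable) (integrable_const _)
    (fun n => ?_) ?_
  · filter_upwards [hM n] with ω h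
    rw [Real.norm_eq_abs, abs_of_nonneg (le_max_right _ _)]
    have := (abs_nonneg _).trans h
    refine max_le ?_ (by positivity)
    linarith [le_abs_self (D n ω), neg_abs_le k]
  · filter_upwards [hD] with ω h
    exact (h.sub_const k).max tendsto_const_nhds

/-- Inductive step in the choice of `δ`. If no `x` worked, the counterexamples for `x = 1/(j+1)`
would form decreasing convex bounded sets. An a.s. limit `Y` of a selection has `n`-th excess zero,
so `Y ≤ n`, and satisfies `ρ (X - Y) ≤ a` by the Fatou property, contradicting the previous stage.
-/
theorem excess_lt_step {ρ : Lp ℝ ∞ P → ℝ} (hρ : IsConvexPrice P ρ) (X : Lp ℝ ∞ P) (a : ℝ)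
    (n : ℕ) (δ : ℕ → ℝ)
    (h : ∀ D : Lp ℝ ∞ P, 0 ≤ D → (∀ᵐ ω ∂P, D ω ≤ n) → (∀ k < n, excess P k D ≤ δ k) →
      a < ρ (X - D)) :
    ∃ x > 0, ∀ D : Lp ℝ ∞ P, 0 ≤ D → (∀ᵐ ω ∂P, D ω ≤ n + 1) → (∀ k < n, excess P k D ≤ δ k) →
      excess P n D ≤ x → a < ρ (X - D) := by
  by_contra! hcon
  set C : ℕ → Set (Lp ℝ ∞ P) := fun j => {D | 0 ≤ D ∧ (∀ᵐ ω ∂P, D ω ≤ n + 1) ∧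
    (∀ k < n, excess P k D ≤ δ k) ∧ excess P n D ≤ 1 / ((j : ℝ) + 1) ∧ ρ (X - D) ≤ a} with hC
  have hne : ∀ j, (C j).Nonempty := fun j => by
    obtain ⟨D, h1, h2, h3, h4, h5⟩ := hcon (1 / ((j : ℝ) + 1)) (by positivity)
    exact ⟨D, h1, h2, h3, h4, h5⟩
  have hanti : Antitone C := by
    rintro i j hij D ⟨h1, h2, h3, h4, h5⟩
    exact ⟨h1, h2, h3, h4.trans (by gcongr), h5⟩
  have hconv : ∀ j, Convex ℝ (C j) := by
    rintro j D ⟨h1, h2, h3, h4, h5⟩ E ⟨g1, g2, g3, g4, g5⟩ s t hs ht hst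
    refine ⟨add_nonneg (Linfty_smul_nonneg hs h1) (Linfty_smul_nonneg ht g1), ?_, fun k hk => ?_, ?_, ?_⟩
    · filter_upwards [h2, g2, Lp.coeFn_add (s • D) (t • E), Lp.coeFn_smul s D, Lp.coeFn_smul t E]
        with ω a1 a2 a3 a4 a5
      simp only [a3, a4, a5, Pi.add_apply, Pi.smul_apply, smul_eq_mul]
      calc s * D ω + t * E ω ≤ s * (n + 1) + t * (n + 1) := by gcongr
        _ = n + 1 := by rw [← add_mul, hst, one_mul]
    · refine (excess_convex k D E hs ht hst).trans ?_
      calc s * excess P k D + t * excess P k E ≤ s * δ k + t * δ k := by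
            gcongr; exacts [h3 k hk, g3 k hk]
        _ = δ k := by rw [← add_mul, hst, one_mul]
    · refine (excess_convex n D E hs ht hst).trans ?_
      calc s * excess P n D + t * excess P n E
            ≤ s * (1 / ((j : ℝ) + 1)) + t * (1 / ((j : ℝ) + 1)) := by gcongr
        _ = 1 / ((j : ℝ) + 1) := by rw [← add_mul, hst, one_mul]
    · have ht' : t = 1 - s := by linarith
      subst ht'
      have : X - (s • D + (1 - s) • E) = s • (X - D) + (1 - s) • (X - E) := by module
      rw [this]
      refine (hρ.convex _ _ s hs (by linarith)).trans ?_
      calc s * ρ (X - D) + (1 - s) * ρ (X - E) ≤ s * a + (1 - s) * a := by gcongr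
        _ = a := by ring
  have hbd : ∀ j, ∀ D ∈ C j, ∀ᵐ ω ∂P, |D ω| ≤ n + 1 := by
    rintro j D ⟨h1, h2, -⟩
    filter_upwards [h2, (Lp.coeFn_nonneg D).2 h1] with ω a1 a2
    rw [abs_le]
    exact ⟨by linarith [show (0 : ℝ) ≤ D ω from a2, show (0 : ℝ) ≤ n from n.cast_nonneg], a1⟩
  obtain ⟨D, Y, hD, hlim⟩ := exists_ae_tendsto_of_antitone_convex C hconv hne hanti (hbd 0)
  have hDM : ∀ j, ∀ᵐ ω ∂P, |D j ω| ≤ n + 1 := fun j => hbd j _ (hD j)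
  have hY0 : 0 ≤ Y := by
    rw [← Lp.coeFn_nonneg]
    filter_upwards [hlim, ae_all_iff.2 fun j => (Lp.coeFn_nonneg (D j)).2 (hD j).1] with ω a1 a2
    exact ge_of_tendsto a1 (Eventually.of_forall a2)
  have hYn : excess P n Y ≤ 0 :=
    le_of_tendsto_of_tendsto' (excess_tendsto n hDM hlim) tendsto_one_div_add_atTop_nhds_zero_nat
      fun j => (hD j).2.2.2.1
  have hYle : ∀ᵐ ω ∂P, Y ω ≤ n := by
    have h0 := (integral_eq_zero_iff_of_nonneg (fun _ => le_max_right _ _)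
      (excess_integrable (n : ℝ) Y)).1 (le_antisymm hYn (excess_nonneg _ _))
    filter_upwards [h0] with ω h0
    have h1 : max (Y ω - n) 0 = 0 := h0
    exact sub_nonpos.1 (max_eq_right_iff.1 h1)
  refine absurd (h Y hY0 hYle fun k hk => ?_) (not_lt.2 ?_)
  · exact le_of_tendsto' (excess_tendsto k hDM hlim) fun j => (hD j).2.2.1 k hk
  · obtain ⟨M, -, hM⟩ := Linfty_exists_bound X
    refine hρ.le_of_ae_tendsto (X := fun j => X - D j) (M := M + (n + 1)) (fun j => ?_) ?_
      fun j => (hD j).2.2.2.2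
    · filter_upwards [hM, hDM j, Lp.coeFn_sub X (D j)] with ω a1 a2 a3
      rw [a3]
      exact (abs_sub _ _).trans (add_le_add a1 a2)
    · filter_upwards [hlim, Lp.coeFn_sub X Y, ae_all_iff.2 fun j => Lp.coeFn_sub X (D j)]
        with ω a1 a2 a3
      simp only [a2, a3, Pi.sub_apply]
      exact a1.const_sub _

/-- The thresholds `δ k` are chosen one at a time, stage `n` handling `0 ≤ D ≤ n`. Each `D` is
bounded above, so a finite stage suffices for it. The point is that one sequence `δ`, independent of
the bound on `D`, serves all. -/
theorem exists_excess_lt {ρ : Lp ℝ ∞ P → ℝ} (hρ : IsConvexPrice P ρ) (X : Lp ℝ ∞ P) {a : ℝ}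
    (ha : a < ρ X) :
    ∃ δ : ℕ → ℝ, (∀ k, 0 < δ k) ∧ ∀ D : Lp ℝ ∞ P, (∀ k : ℕ, excess P k D ≤ δ k) →
      a < ρ (X - D) := by
  let good : ℕ → (ℕ → ℝ) → Prop := fun n δ => (∀ k, 0 < δ k) ∧
    ∀ D : Lp ℝ ∞ P, 0 ≤ D → (∀ᵐ ω ∂P, D ω ≤ n) → (∀ k < n, excess P k D ≤ δ k) → a < ρ (X - D)
  have h0 : good 0 fun _ => 1 := by
    refine ⟨fun _ => one_pos, fun D h1 h2 _ => ?_⟩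
    have : D = 0 := by
      refine le_antisymm ?_ h1
      rw [← Lp.coeFn_le]
      filter_upwards [h2, Lp.coeFn_zero ℝ ∞ P] with ω a1 a2
      simpa [a2] using a1
    rwa [this, sub_zero]
  have hstep : ∀ n δ, good n δ → ∃ x, good (n + 1) (Function.update δ n x) := by
    rintro n δ ⟨hpos, h⟩
    obtain ⟨x, hx, hx'⟩ := excess_lt_step hρ X a n δ h
    refine ⟨x, fun k => ?_, fun D h1 h2 h3 => hx' D h1 (by simpa using h2) (fun k hk => ?_) ?_⟩
    · by_cases hk : k = n
      · subst hk; simpa using hx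
      · simpa [hk] using hpos k
    · simpa [hk.ne] using h3 k (by omega)
    · simpa using h3 n (by omega)
  choose! x hx using hstep
  let s : ℕ → ℕ → ℝ := fun n => Nat.rec (fun _ => 1) (fun n δ => Function.update δ n (x n δ)) n
  have hs : ∀ n, good n (s n) := fun n => by
    induction n with
    | zero => exact h0
    | succ n ih => exact hx n _ ih
  -- Coordinate `k` is set at stage `k + 1` and never altered later, so the diagonal agrees with
  -- stage `n` on all `k < n`.
  have hstable : ∀ k j, s (k + 1 + j) k = s (k + 1) k := fun k j => by
    induction j with
    | zero => rfl
    | succ j ih =>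
      rw [← ih]
      change Function.update (s (k + 1 + j)) (k + 1 + j) _ k = _
      rw [Function.update_of_ne (by omega)]
  refine ⟨fun k => s (k + 1) k, fun k => (hs (k + 1)).1 k, fun D hD => ?_⟩
  obtain ⟨M, -, hM⟩ := Linfty_exists_bound D
  obtain ⟨n, hn⟩ := exists_nat_ge M
  have hsup : ∀ᵐ ω ∂P, (D ⊔ 0 : Lp ℝ ∞ P) ω = max (D ω) 0 := by
    filter_upwards [Lp.coeFn_sup D 0, Lp.coeFn_zero ℝ ∞ P] with ω a1 a2
    rw [a1, Pi.sup_apply, a2, Pi.zero_apply]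
  -- Passing to the positive part changes no excess at a level `k ≥ 0`, and it only lowers `X - D`.
  refine ((hs n).2 (D ⊔ 0) le_sup_right ?_ fun k hk => ?_).trans_le
    (hρ.mono (sub_le_sub_left le_sup_left X))
  · filter_upwards [hsup, hM] with ω a1 a2
    rw [a1]
    exact max_le ((le_abs_self _).trans (a2.trans hn)) n.cast_nonneg
  · obtain ⟨j, rfl⟩ := Nat.exists_eq_add_of_le (Nat.succ_le_of_lt hk)
    have h1 : s (k.succ + j) k = s (k + 1) k := hstable k j
    rw [h1]
    refine le_trans (le_of_eq ?_) (hD k)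
    refine integral_congr_ae ?_
    filter_upwards [hsup] with ω a1
    rw [a1]
    have : (0 : ℝ) ≤ k := k.cast_nonneg
    rcases le_total (D ω) 0 with h | h
    · rw [max_eq_right h, max_eq_right (by linarith), max_eq_right (by linarith)]
    · rw [max_eq_left h]

/-- A positive linear functional on `L^∞` with `f(1_A) → 0` as `P(A) → 0`. -/
theorem exists_functional {ρ : Lp ℝ ∞ P → ℝ} (hρ : IsConvexPrice P ρ) (X : Lp ℝ ∞ P) {ε : ℝ}
    (hε : 0 < ε) : ∃ f : Lp ℝ ∞ P →ₗ[ℝ] ℝ, (∀ D, 0 ≤ D → 0 ≤ f D) ∧ f (Lp.const ∞ P 1) = 1 ∧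
      (∀ η > 0, ∃ κ > 0, ∀ (A : Set Ω) (hA : MeasurableSet A), P.real A < κ →
        f (indicatorConstLp ∞ hA (measure_ne_top P A) 1) < η) ∧
      ∀ Y, f Y ≤ ρ Y + f X - ρ X + ε := by
  obtain ⟨δ, hδ, hδD⟩ := exists_excess_lt hρ X (a := ρ X - ε) (by linarith)
  -- The functional will separate `V` from the positions `K` whose subtraction lowers the price by
  -- at least `ε`.
  set V : Set (Lp ℝ ∞ P) := {D | ∀ k : ℕ, excess P k D ≤ δ k} with hV
  set K : Set (Lp ℝ ∞ P) := {D | ρ (X - D) ≤ ρ X - ε} with hK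
  have hVconv : Convex ℝ V := by
    intro D hD E hE s t hs ht hst k
    refine (excess_convex k D E hs ht hst).trans ?_
    calc s * excess P k D + t * excess P k E ≤ s * δ k + t * δ k := by
          gcongr; exacts [hD k, hE k]
      _ = δ k := by rw [← add_mul, hst, one_mul]
  have hKconv : Convex ℝ K := by
    intro D hD E hE s t hs ht hst
    have ht' : t = 1 - s := by linarith
    subst ht'
    have : X - (s • D + (1 - s) • E) = s • (X - D) + (1 - s) • (X - E) := by module
    change ρ _ ≤ _
    rw [this]
    refine (hρ.convex _ _ s hs (by linarith)).trans ?_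
    calc s * ρ (X - D) + (1 - s) * ρ (X - E) ≤ s * (ρ X - ε) + (1 - s) * (ρ X - ε) := by
          gcongr; exacts [hD, hE]
      _ = ρ X - ε := by ring
  have h0int : (0 : Lp ℝ ∞ P) ∈ interior V := by
    rw [mem_interior_iff_mem_nhds, Metric.mem_nhds_iff]
    -- The bound `δ 0` controls the excess at level `0`; the bound `1` makes all excesses at levels
    -- `k ≥ 1` vanish.
    refine ⟨min 1 (δ 0), lt_min one_pos (hδ 0), fun D hD k => ?_⟩
    rw [Metric.mem_ball, dist_zero_right] at hD
    have hDle : ∀ᵐ ω ∂P, D ω ≤ min 1 (δ 0) := by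
      have h := ae_le_eLpNormEssSup (f := (D : Ω → ℝ)) (μ := P)
      filter_upwards [h] with ω hω
      refine le_trans ?_ hD.le
      refine (le_abs_self _).trans ?_
      rw [Lp.norm_def, eLpNorm_exponent_top, ← Real.norm_eq_abs, ← toReal_enorm]
      refine ENNReal.toReal_mono ?_ hω
      have := Lp.eLpNorm_ne_top D
      rwa [eLpNorm_exponent_top] at this
    rcases Nat.eq_zero_or_pos k with rfl | hk
    · calc excess P _ D ≤ ∫ _, δ 0 ∂P := by
            refine integral_mono_ae (excess_integrable _ D) (integrable_const _) ?_
            filter_upwards [hDle] with ω h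
            simp only [Nat.cast_zero, sub_zero]
            exact max_le (h.trans (min_le_right _ _)) (hδ 0).le
        _ = δ 0 := by simp
    · have : excess P k D = 0 := by
        refine integral_eq_zero_of_ae ?_
        filter_upwards [hDle] with ω h
        refine max_eq_right ?_
        have : (1 : ℝ) ≤ k := by exact_mod_cast hk
        linarith [min_le_left 1 (δ 0)]
      rw [this]
      exact (hδ k).le
  have hdisj : Disjoint (interior V) K := by
    rw [Set.disjoint_left]
    intro D hD hDK
    exact absurd (hδD D (interior_subset hD)) (not_lt.2 hDK)
  obtain ⟨f, u, hfV, hfK⟩ := geometric_hahn_banach_open hVconv.interior isOpen_interior hKconv hdisj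
  have hu : 0 < u := by simpa using hfV 0 h0int
  have hfV' : ∀ D ∈ V, f D ≤ u := by
    intro D hD
    have h1 : D ∈ closure (interior V) := by
      rw [hVconv.closure_interior_eq_closure_of_nonempty_interior ⟨0, h0int⟩]
      exact subset_closure hD
    exact closure_minimal (fun E hE => (hfV E hE).le) (isClosed_le f.continuous continuous_const) h1
  have hpos : ∀ D, 0 ≤ D → 0 ≤ f D := by
    intro D hD
    by_contra! hneg
    -- All nonpositive elements lie in `V`; this multiple of `D` is scaled so that `f` takes the
    -- value `2 * u > u` on it.
    have hmem : (-(2 * u / -f D)) • D ∈ V := by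
      intro k
      have : excess P k ((-(2 * u / -f D)) • D) = 0 := by
        refine integral_eq_zero_of_ae ?_
        filter_upwards [Lp.coeFn_smul (-(2 * u / -f D)) D, (Lp.coeFn_nonneg D).2 hD] with ω a1 a2
        refine max_eq_right ?_
        rw [a1, Pi.smul_apply, smul_eq_mul]
        have h1 : 0 ≤ 2 * u / -f D := div_nonneg (by positivity) (by linarith)
        have h2 := mul_nonneg h1 (show (0 : ℝ) ≤ D ω from a2)
        have : (0 : ℝ) ≤ k := k.cast_nonneg
        linarith
      rw [this]; exact (hδ k).le
    have h1 := hfV' _ hmem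
    rw [map_smul, smul_eq_mul] at h1
    have h2 : -(2 * u / -f D) * f D = 2 * u := by
      rw [div_neg, neg_neg, div_mul_cancel₀ _ hneg.ne]
    linarith
  have hconst : ∀ c : ℝ, Lp.const ∞ P c = c • Lp.const ∞ P (1 : ℝ) := fun c => by
    have := (Lp.constₗ ∞ P ℝ).map_smul c (1 : ℝ)
    simpa using this
  set b := f (Lp.const ∞ P (1 : ℝ)) with hb
  have hbpos : 0 < b := by
    have h1 : Lp.const ∞ P ε ∈ K := by
      have := hρ.cash (X - Lp.const ∞ P ε) ε
      rw [sub_add_cancel] at this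
      change ρ (X - Lp.const ∞ P ε) ≤ ρ X - ε
      linarith
    have h2 := hfK _ h1
    rw [hconst, map_smul, smul_eq_mul] at h2
    exact pos_of_mul_pos_right (hu.trans_le h2) hε.le
  refine ⟨b⁻¹ • (f : Lp ℝ ∞ P →ₗ[ℝ] ℝ), fun D hD => ?_, ?_, fun η hη => ?_, fun Y => ?_⟩
  · exact mul_nonneg (inv_nonneg.2 hbpos.le) (hpos D hD)
  · exact inv_mul_cancel₀ hbpos.ne'
  -- The excess of `N 1_A` at level `k` is `P(A) (N - k)^+`, so only the levels `k < N` constrain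
  -- `P(A)`. Once `N 1_A` lies in `V`, the normalized functional is at most `b⁻¹ * u / N < η` on
  -- `1_A`.
  · obtain ⟨N, hN⟩ := exists_nat_gt (b⁻¹ * u / η)
    have hN0 : (0 : ℝ) < N := lt_of_le_of_lt (by positivity) hN
    obtain ⟨κ, hκ, hκ'⟩ : ∃ κ > 0, ∀ k < N, κ * N ≤ δ k := by
      have hfin : (Finset.range (N + 1)).Nonempty := ⟨0, by simp⟩
      refine ⟨((Finset.range (N + 1)).inf' hfin δ) / N, div_pos ?_ hN0, fun k hk => ?_⟩
      · rw [Finset.lt_inf'_iff]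
        exact fun k _ => hδ k
      · rw [div_mul_cancel₀ _ hN0.ne']
        exact Finset.inf'_le _ (by simp; omega)
    refine ⟨κ, hκ, fun A hA hPA => ?_⟩
    set I := indicatorConstLp ∞ hA (measure_ne_top P A) (1 : ℝ) with hI
    have hmem : (N : ℝ) • I ∈ V := by
      intro k
      have hval : ∀ᵐ ω ∂P, max (((N : ℝ) • I : Lp ℝ ∞ P) ω - k) 0
          = A.indicator (fun _ => max ((N : ℝ) - k) 0) ω := by
        filter_upwards [Lp.coeFn_smul (N : ℝ) I, indicatorConstLp_coeFn (p := ∞) (hs := hA)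
          (hμs := measure_ne_top P A) (c := (1 : ℝ))] with ω a1 a2
        rw [a1, Pi.smul_apply, hI, a2]
        by_cases h : ω ∈ A
        · simp [h]
        · simp [h]
      have hval' : excess P k ((N : ℝ) • I) = P.real A * max ((N : ℝ) - k) 0 := by
        unfold excess
        rw [integral_congr_ae hval, integral_indicator hA, setIntegral_const, smul_eq_mul]
      rw [hval']
      rcases lt_or_ge k N with hk | hk
      · refine le_trans ?_ (hκ' k hk)
        have : max ((N : ℝ) - k) 0 ≤ N :=
          max_le (by linarith [show (0 : ℝ) ≤ k from k.cast_nonneg]) hN0.le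
        gcongr
      · rw [max_eq_right (by rw [sub_nonpos]; exact_mod_cast hk), mul_zero]
        exact (hδ k).le
    have h1 := hfV' _ hmem
    rw [map_smul, smul_eq_mul] at h1
    change b⁻¹ * f I < η
    rw [div_lt_iff₀ hη] at hN
    have h2 : (N : ℝ) * (b⁻¹ * f I) ≤ b⁻¹ * u := by
      have := mul_le_mul_of_nonneg_left h1 (inv_nonneg.2 hbpos.le)
      linarith
    exact lt_of_mul_lt_mul_left (h2.trans_lt hN) hN0.le
  -- The constant is the one for which subtracting this element from `X` gives price exactly `ρ X -
  -- ε`.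
  · have hmem : X - Y + Lp.const ∞ P (ρ Y - ρ X + ε) ∈ K := by
      have h1 := hρ.cash (X - (X - Y + Lp.const ∞ P (ρ Y - ρ X + ε))) (ρ Y - ρ X + ε)
      have h2 : X - (X - Y + Lp.const ∞ P (ρ Y - ρ X + ε)) + Lp.const ∞ P (ρ Y - ρ X + ε) = Y := by
        abel
      rw [h2] at h1
      change ρ (X - (X - Y + Lp.const ∞ P (ρ Y - ρ X + ε))) ≤ ρ X - ε
      linarith
    have h1 := hfK _ hmem
    rw [map_add, map_sub, hconst, map_smul, smul_eq_mul, ← hb] at h1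
    change b⁻¹ * f Y ≤ ρ Y + b⁻¹ * f X - ρ X + ε
    have h2 : 0 ≤ b⁻¹ * (f X - f Y + (ρ Y - ρ X + ε) * b) :=
      mul_nonneg (inv_nonneg.2 hbpos.le) (hu.le.trans h1)
    have h3 : b⁻¹ * (f X - f Y + (ρ Y - ρ X + ε) * b)
        = b⁻¹ * f X - b⁻¹ * f Y + (ρ Y - ρ X + ε) := by field_simp
    linarith

end Representation

/-! ### From positive functionals to probability measures. -/

section Measure

variable {Ω : Type*} {m : MeasurableSpace Ω}

/-- Rounding `g` down to a multiple of `η` takes finitely many values because `g` is bounded. -/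
theorem exists_simpleFunc_abs_sub_le {g : Ω → ℝ} (hg : Measurable g) {M : ℝ}
    (hM : ∀ ω, |g ω| ≤ M) {η : ℝ} (hη : 0 < η) :
    ∃ s : SimpleFunc Ω ℝ, ∀ ω, |g ω - s ω| ≤ η := by
  have hmeas : Measurable fun ω => (⌊g ω / η⌋ : ℝ) * η :=
    ((measurable_from_top (f := fun k : ℤ => (k : ℝ))).comp
      (Int.measurable_floor.comp (hg.div_const η))).mul_const η
  refine ⟨⟨fun ω => (⌊g ω / η⌋ : ℝ) * η, fun x => hmeas (measurableSet_singleton x), ?_⟩,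
    fun ω => ?_⟩
  · refine ((Set.finite_Icc ⌊-M / η⌋ ⌊M / η⌋).image fun k : ℤ => (k : ℝ) * η).subset ?_
    rintro _ ⟨ω, rfl⟩
    have h := abs_le.1 (hM ω)
    exact ⟨⌊g ω / η⌋, ⟨Int.floor_le_floor (by gcongr; exact h.1),
      Int.floor_le_floor (by gcongr; exact h.2)⟩, rfl⟩
  · change |g ω - (⌊g ω / η⌋ : ℝ) * η| ≤ η
    have h1 := Int.floor_le (g ω / η)
    have h2 := Int.lt_floor_add_one (g ω / η)
    rw [le_div_iff₀ hη] at h1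
    rw [div_lt_iff₀ hη] at h2
    rw [abs_le]
    constructor <;> nlinarith

variable {P : Measure Ω} [IsProbabilityMeasure P]

/-- The class in `L^∞` of the indicator function of a measurable set. -/
noncomputable def ind (P : Measure Ω) [IsProbabilityMeasure P] {A : Set Ω}
    (hA : MeasurableSet A) : Lp ℝ ∞ P :=
  indicatorConstLp ∞ hA (measure_ne_top P A) 1

theorem coeFn_ind {A : Set Ω} (hA : MeasurableSet A) :
    ind P hA =ᵐ[P] A.indicator fun _ => 1 := indicatorConstLp_coeFn

theorem ind_nonneg {A : Set Ω} (hA : MeasurableSet A) : 0 ≤ ind P hA := by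
  rw [← Lp.coeFn_nonneg]
  filter_upwards [coeFn_ind (P := P) hA] with ω h
  rw [h]
  exact Set.indicator_nonneg (fun _ _ => zero_le_one) ω

theorem ind_union {A B : Set Ω} (hA : MeasurableSet A) (hB : MeasurableSet B)
    (hAB : Disjoint A B) : ind P (hA.union hB) = ind P hA + ind P hB :=
  indicatorConstLp_disjoint_union hA hB (measure_ne_top P A) (measure_ne_top P B) hAB 1

theorem ind_eq_zero {A : Set Ω} (hA : MeasurableSet A) (h : P A = 0) : ind P hA = 0 := by
  refine Lp.ext ?_
  filter_upwards [coeFn_ind (P := P) hA, Lp.coeFn_zero ℝ ∞ P, measure_eq_zero_iff_ae_notMem.1 h]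
    with ω h1 h2 h3
  rw [h1, h2, Set.indicator_of_notMem h3]; rfl

theorem abs_functional_le {f : Lp ℝ ∞ P →ₗ[ℝ] ℝ} (hpos : ∀ D, 0 ≤ D → 0 ≤ f D)
    (hone : f (Lp.const ∞ P 1) = 1) {Z : Lp ℝ ∞ P} {η : ℝ} (hZ : ∀ᵐ ω ∂P, |Z ω| ≤ η) :
    |f Z| ≤ η := by
  have hval : f (η • Lp.const ∞ P 1) = η := by rw [map_smul, hone, smul_eq_mul, mul_one]
  have hc : ∀ᵐ ω ∂P, (η • Lp.const ∞ P (1 : ℝ) : Lp ℝ ∞ P) ω = η := by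
    filter_upwards [Lp.coeFn_smul η (Lp.const ∞ P (1 : ℝ)), Lp.coeFn_const (p := ∞) P (1 : ℝ)]
      with ω h1 h2
    rw [h1, Pi.smul_apply, h2, Function.const_apply, smul_eq_mul, mul_one]
  rw [abs_le]
  constructor
  · have := hpos (Z + η • Lp.const ∞ P 1) (by
      rw [← Lp.coeFn_nonneg]
      filter_upwards [hZ, hc, Lp.coeFn_add Z (η • Lp.const ∞ P 1)] with ω h1 h2 h3
      rw [h3, Pi.add_apply, h2, Pi.zero_apply]
      linarith [(abs_le.1 h1).1])
    rw [map_add, hval] at this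
    linarith
  · have := hpos (η • Lp.const ∞ P 1 - Z) (by
      rw [← Lp.coeFn_nonneg]
      filter_upwards [hZ, hc, Lp.coeFn_sub (η • Lp.const ∞ P 1) Z] with ω h1 h2 h3
      rw [h3, Pi.sub_apply, h2, Pi.zero_apply]
      linarith [(abs_le.1 h1).2])
    rw [map_sub, hval] at this
    linarith

/-- A normalized positive linear functional on `L^∞` that is uniformly small on the indicators of
sets of small probability is the expectation under a probability measure `Q ≪ P`. -/
theorem exists_measure_of_functional {f : Lp ℝ ∞ P →ₗ[ℝ] ℝ} (hpos : ∀ D, 0 ≤ D → 0 ≤ f D)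
    (hone : f (Lp.const ∞ P 1) = 1)
    (hsmall : ∀ η > 0, ∃ κ > 0, ∀ (A : Set Ω) (hA : MeasurableSet A), P.real A < κ →
      f (ind P hA) < η) :
    ∃ Q : Measure Ω, IsProbabilityMeasure Q ∧ Q ≪ P ∧ ∀ Y : Lp ℝ ∞ P, ∫ ω, Y ω ∂Q = f Y := by
  have hnn : ∀ {A : Set Ω} (hA : MeasurableSet A), 0 ≤ f (ind P hA) :=
    fun hA => hpos _ (ind_nonneg hA)
  have hsum : ∀ (A : ℕ → Set Ω) (hA : ∀ i, MeasurableSet (A i)), Pairwise (Function.onFun Disjoint A) →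
      HasSum (fun i => f (ind P (hA i))) (f (ind P (MeasurableSet.iUnion hA))) := by
    intro A hA hdisj
    -- The tails decrease to the empty set, so their probabilities tend to zero and `hsmall` makes
    -- the remainder in the finite additivity formula vanish.
    have hR : ∀ n, MeasurableSet (⋃ i, A (n + i)) := fun n => MeasurableSet.iUnion fun i => hA _
    have hsplit : ∀ n, f (ind P (MeasurableSet.iUnion hA))
        = ∑ i ∈ Finset.range n, f (ind P (hA i)) + f (ind P (hR n)) := by
      intro n
      induction n with
      | zero => simp
      | succ n ih =>
        have hun : ⋃ i, A (n + i) = A n ∪ ⋃ i, A (n + 1 + i) := by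
          ext ω
          simp only [Set.mem_iUnion, Set.mem_union]
          constructor
          · rintro ⟨i, hi⟩
            rcases i with _ | i
            · exact Or.inl hi
            · exact Or.inr ⟨i, by rwa [show n + 1 + i = n + (i + 1) by omega]⟩
          · rintro (h | ⟨i, hi⟩)
            · exact ⟨0, h⟩
            · exact ⟨i + 1, by rwa [show n + (i + 1) = n + 1 + i by omega]⟩
        have hd : Disjoint (A n) (⋃ i, A (n + 1 + i)) :=
          Set.disjoint_iUnion_right.2 fun i => hdisj (by omega)
        have h1 : ind P (hR n) = ind P (hA n) + ind P (hR (n + 1)) := by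
          rw [← ind_union (hA n) (hR (n + 1)) hd]
          congr 1
        rw [ih, Finset.sum_range_succ, h1, map_add]
        ring
    rw [hasSum_iff_tendsto_nat_of_nonneg fun i => hnn (hA i)]
    have hPR : Tendsto (fun n => P.real (⋃ i, A (n + i))) atTop (𝓝 0) := by
      have h1 : Tendsto (fun n => P (⋃ i, A (n + i))) atTop (𝓝 (P (⋂ n, ⋃ i, A (n + i)))) := by
        refine tendsto_measure_iInter_atTop (fun n => (hR n).nullMeasurableSet) ?_
          ⟨0, measure_ne_top _ _⟩
        intro a b hab
        refine Set.iUnion_subset fun i => ?_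
        have := Set.subset_iUnion (fun i => A (a + i)) (b - a + i)
        simpa [show a + (b - a + i) = b + i by omega] using this
      have h2 : ⋂ n, ⋃ i, A (n + i) = ∅ := by
        ext ω
        simp only [Set.mem_iInter, Set.mem_iUnion, Set.mem_empty_iff_false, iff_false, not_forall,
          not_exists]
        by_cases h : ∃ i, ω ∈ A i
        · obtain ⟨i, hi⟩ := h
          refine ⟨i + 1, fun j hj => ?_⟩
          exact Set.disjoint_left.1 (hdisj (show i ≠ i + 1 + j by omega)) hi hj
        · exact ⟨0, fun i hi => h ⟨_, hi⟩⟩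
      rw [h2, measure_empty] at h1
      exact (ENNReal.tendsto_toReal ENNReal.zero_ne_top).comp h1
    have hfR : Tendsto (fun n => f (ind P (hR n))) atTop (𝓝 0) := by
      refine tendsto_order.2 ⟨fun a ha => Eventually.of_forall fun n => ha.trans_le (hnn _),
        fun η hη => ?_⟩
      obtain ⟨κ, hκ, hκ'⟩ := hsmall η hη
      filter_upwards [hPR.eventually (gt_mem_nhds hκ)] with n hn
      exact hκ' _ _ hn
    have h3 := hfR.const_sub (f (ind P (MeasurableSet.iUnion hA)))
    rw [sub_zero] at h3
    refine h3.congr fun n => ?_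
    rw [hsplit n]; ring
  have hempty : f (ind P MeasurableSet.empty) = 0 := by
    rw [ind_eq_zero _ measure_empty, map_zero]
  let Q : Measure Ω := Measure.ofMeasurable (fun A hA => ENNReal.ofReal (f (ind P hA)))
    (by simp [hempty]) fun A hA hdisj => by
      have h := hsum A hA hdisj
      rw [← ENNReal.ofReal_tsum_of_nonneg (fun i => hnn (hA i)) h.summable, h.tsum_eq]
  have hQ : ∀ {A : Set Ω} (hA : MeasurableSet A), Q A = ENNReal.ofReal (f (ind P hA)) :=
    fun hA => Measure.ofMeasurable_apply _ hA
  have hQP : Q ≪ P := Measure.AbsolutelyContinuous.mk fun A hA h0 => by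
    rw [hQ hA, ind_eq_zero hA h0, map_zero, ENNReal.ofReal_zero]
  have huniv : Q Set.univ = 1 := by
    rw [hQ MeasurableSet.univ]
    have : ind P MeasurableSet.univ = Lp.const ∞ P (1 : ℝ) := by
      refine Lp.ext ?_
      filter_upwards [coeFn_ind (P := P) MeasurableSet.univ, Lp.coeFn_const (p := ∞) P (1 : ℝ)]
        with ω h1 h2
      rw [h1, h2, Set.indicator_univ]; rfl
    rw [this, hone, ENNReal.ofReal_one]
  have hprob : IsProbabilityMeasure Q := ⟨huniv⟩
  have hsimple : ∀ (s : SimpleFunc Ω ℝ) (S : Lp ℝ ∞ P), S =ᵐ[P] s → ∫ ω, s ω ∂Q = f S := by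
    intro s
    induction s using SimpleFunc.induction with
    | const c hA =>
      rename_i A
      intro S hS
      have h1 : S = c • ind P hA := by
        refine Lp.ext ?_
        filter_upwards [hS, Lp.coeFn_smul c (ind P hA), coeFn_ind (P := P) hA] with ω h1 h2 h3
        rw [h1, h2, Pi.smul_apply, h3]
        by_cases h : ω ∈ A <;> simp [h]
      have h2 : ∀ ω, (SimpleFunc.piecewise A hA (SimpleFunc.const Ω c) (SimpleFunc.const Ω 0)) ω
          = A.indicator (fun _ => c) ω := fun ω => by
        by_cases h : ω ∈ A <;> simp [h]
      simp_rw [h2]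
      rw [integral_indicator hA, setIntegral_const, h1, map_smul, smul_eq_mul, smul_eq_mul,
        Measure.real, hQ hA, ENNReal.toReal_ofReal (hnn hA), mul_comm]
    | add hst hs ht =>
      rename_i s t
      intro S hS
      have hb : ∀ u : SimpleFunc Ω ℝ, ∃ U : Lp ℝ ∞ P, U =ᵐ[P] u := fun u => by
        obtain ⟨C, hC⟩ := u.exists_forall_norm_le
        exact exists_Linfty_ae_eq u.measurable.aestronglyMeasurable (Eventually.of_forall hC)
      obtain ⟨U, hU⟩ := hb s
      obtain ⟨V, hV⟩ := hb t
      have h1 : S = U + V := by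
        refine Lp.ext ?_
        filter_upwards [hS, hU, hV, Lp.coeFn_add U V] with ω h1 h2 h3 h4
        rw [h1, h4, Pi.add_apply, h2, h3]; rfl
      rw [h1, map_add, ← hs U hU, ← ht V hV, ← integral_add]
      · rfl
      · exact s.integrable_of_isFiniteMeasure
      · exact t.integrable_of_isFiniteMeasure
  refine ⟨Q, hprob, hQP, fun Y => ?_⟩
  obtain ⟨M, hM0, hM⟩ := Linfty_exists_bound Y
  have hYm := (Lp.aestronglyMeasurable Y).aemeasurable
  -- Truncation gives a representative bounded everywhere, as uniform approximation by simple
  -- functions requires.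
  let g : Ω → ℝ := fun ω => max (-M) (min M (hYm.mk Y ω))
  have hg : Measurable g := measurable_const.max (measurable_const.min hYm.measurable_mk)
  have hgM : ∀ ω, |g ω| ≤ M := fun ω => abs_le.2
    ⟨le_max_left _ _, max_le (by linarith) (min_le_left _ _)⟩
  have hYg : Y =ᵐ[P] g := by
    filter_upwards [hYm.ae_eq_mk, hM] with ω h1 h2
    have h3 := abs_le.1 h2
    simp only [g]
    rw [← h1, min_eq_right h3.2, max_eq_right h3.1]
  have hclose : ∀ η > 0, |(∫ ω, Y ω ∂Q) - f Y| ≤ η + η := by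
    intro η hη
    obtain ⟨s, hs⟩ := exists_simpleFunc_abs_sub_le hg hgM hη
    obtain ⟨C, hC⟩ := s.exists_forall_norm_le
    obtain ⟨S, hS⟩ := exists_Linfty_ae_eq (P := P) s.measurable.aestronglyMeasurable
      (Eventually.of_forall hC)
    have h1 : |f (S - Y)| ≤ η := abs_functional_le hpos hone (by
      filter_upwards [hS, hYg, Lp.coeFn_sub S Y] with ω a1 a2 a3
      rw [a3, Pi.sub_apply, a1, a2, abs_sub_comm]
      exact hs ω)
    have h2 : |∫ ω, (Y ω - s ω) ∂Q| ≤ η := by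
      have := norm_integral_le_of_norm_le_const (μ := Q) (f := fun ω => Y ω - s ω) (C := η) (by
        filter_upwards [hQP.ae_le hYg] with ω a1
        rw [a1]
        exact hs ω)
      simpa using this
    rw [integral_sub (Linfty_integrable_of_ac hQP Y) s.integrable_of_isFiniteMeasure,
      hsimple s S hS] at h2
    rw [map_sub] at h1
    calc |(∫ ω, Y ω ∂Q) - f Y| = |((∫ ω, Y ω ∂Q) - f S) + (f S - f Y)| := by ring_nf
      _ ≤ _ := (abs_add_le _ _).trans (add_le_add h2 h1)
  by_contra hne
  have h0 : 0 < |(∫ ω, Y ω ∂Q) - f Y| := abs_pos.2 (sub_ne_zero.2 hne)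
  have := hclose (|(∫ ω, Y ω ∂Q) - f Y| / 4) (by positivity)
  linarith

/-- The robust representation of `ρ`: at every `X`, an almost optimal probability measure. -/
theorem IsConvexPrice.exists_measure {ρ : Lp ℝ ∞ P → ℝ} (hρ : IsConvexPrice P ρ) (X : Lp ℝ ∞ P)
    {ε : ℝ} (hε : 0 < ε) : ∃ Q : Measure Ω, IsProbabilityMeasure Q ∧ Q ≪ P ∧
      ∀ Y : Lp ℝ ∞ P, ∫ ω, Y ω ∂Q ≤ ρ Y + (∫ ω, X ω ∂Q) - ρ X + ε := by
  obtain ⟨f, h1, h2, h3, h4⟩ := exists_functional hρ X hε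
  obtain ⟨Q, hQ, hQP, hQf⟩ := exists_measure_of_functional h1 h2 h3
  exact ⟨Q, hQ, hQP, fun Y => by rw [hQf, hQf]; exact h4 Y⟩

end Measure

/-! ### Weak-star separation, exhaustion, and the Kreps-Yan theorem. -/

section KrepsYan

variable {Ω : Type*} {m : MeasurableSpace Ω} {P : Measure Ω}

/-- The pairing `E(X g)` of `X ∈ L^∞` with `g ∈ L^1`, as a functional of `g`. -/
noncomputable def pairing (X : Lp ℝ ∞ P) : Lp ℝ 1 P →L[ℝ] ℝ :=
  LinearMap.mkContinuousOfExistsBound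
    { toFun := fun g => ∫ ω, X ω * g ω ∂P
      map_add' := fun g h => by
        rw [← integral_add (Linfty_mul_integrable X g) (Linfty_mul_integrable X h)]
        refine integral_congr_ae ?_
        filter_upwards [Lp.coeFn_add g h] with ω h1
        rw [h1, Pi.add_apply, mul_add]
      map_smul' := fun r g => by
        rw [RingHom.id_apply, smul_eq_mul, ← integral_const_mul]
        refine integral_congr_ae ?_
        filter_upwards [Lp.coeFn_smul r g] with ω h1
        rw [h1, Pi.smul_apply, smul_eq_mul, mul_left_comm] }
    (by
      obtain ⟨M, hM0, hM⟩ := Linfty_exists_bound X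
      refine ⟨M, fun g => ?_⟩
      rw [L1.norm_eq_integral_norm, ← integral_const_mul]
      refine norm_integral_le_of_norm_le ((L1.integrable_coeFn g).norm.const_mul M) ?_
      filter_upwards [hM] with ω h
      rw [norm_mul]
      exact mul_le_mul_of_nonneg_right h (norm_nonneg _))

theorem pairing_apply (X : Lp ℝ ∞ P) (g : Lp ℝ 1 P) : pairing X g = ∫ ω, X ω * g ω ∂P := rfl

theorem pairing_smul_add (a b : ℝ) (X Y : Lp ℝ ∞ P) (g : Lp ℝ 1 P) :
    pairing (a • X + b • Y) g = a * pairing X g + b * pairing Y g := by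
  simp only [pairing_apply]
  rw [← integral_const_mul, ← integral_const_mul, ← integral_add
    ((Linfty_mul_integrable X g).const_mul a) ((Linfty_mul_integrable Y g).const_mul b)]
  refine integral_congr_ae ?_
  filter_upwards [Lp.coeFn_add (a • X) (b • Y), Lp.coeFn_smul a X, Lp.coeFn_smul b Y]
    with ω h1 h2 h3
  rw [h1, Pi.add_apply, h2, h3]
  simp only [Pi.smul_apply, smul_eq_mul]
  ring

/-- A point outside the weak-star closure of a convex cone is separated from it by some
`g ∈ L^1`. -/
theorem exists_pairing_pos {C : Set (Lp ℝ ∞ P)} (hconv : Convex ℝ C) (h0 : 0 ∈ C)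
    (hcone : ∀ (r : ℝ), 0 ≤ r → ∀ X ∈ C, r • X ∈ C) {Z : Lp ℝ ∞ P}
    (hZ : Z ∉ @closure _ (weakStarTopology P) C) :
    ∃ g : Lp ℝ 1 P, (∀ X ∈ C, pairing X g ≤ 0) ∧ 0 < pairing Z g := by
  classical
  -- A basic neighbourhood of `Z` involves a finite set `I` of test functions. The separation is
  -- thus done in `I → ℝ`, and the separating functional pulls back to the pairing with a linear
  -- combination of them.
  rw [weakStarTopology, closure_induced] at hZ
  obtain ⟨I, u, hu, hsub⟩ := isOpen_pi_iff.1 isClosed_closure.isOpen_compl _ hZ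
  let T : Lp ℝ ∞ P → (I → ℝ) := fun X g => pairing X g.1
  have hTlin : ∀ (a b : ℝ) X Y, T (a • X + b • Y) = a • T X + b • T Y := fun a b X Y => by
    funext g
    exact pairing_smul_add a b X Y g.1
  have hT0 : T 0 = 0 := by simpa using hTlin 0 0 0 0
  have hTconv : Convex ℝ (closure (T '' C)) := by
    refine Convex.closure ?_
    rintro _ ⟨X, hX, rfl⟩ _ ⟨Y, hY, rfl⟩ a b ha hb hab
    exact ⟨_, hconv hX hY ha hb hab, hTlin a b X Y⟩
  have hTZ : T Z ∉ closure (T '' C) := by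
    intro h
    have hopen : IsOpen (Set.univ.pi fun g : I => u g.1) :=
      isOpen_set_pi Set.finite_univ fun g _ => (hu g.1 g.2).1
    obtain ⟨_, hmem, ⟨X, hX, rfl⟩⟩ :=
      mem_closure_iff.1 h _ hopen fun g _ => (hu g.1 g.2).2
    refine hsub (a := fun g => pairing X g) (fun g hg => hmem ⟨g, hg⟩ trivial) ?_
    exact subset_closure ⟨X, hX, rfl⟩
  obtain ⟨φ, c, hφ, hφZ⟩ := geometric_hahn_banach_closed_point hTconv isClosed_closure hTZ
  have hrep : ∀ X, φ (T X)
      = pairing X (∑ g : I, (φ fun j => if g = j then 1 else 0) • (g.1 : Lp ℝ 1 P)) := by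
    intro X
    have := LinearMap.pi_apply_eq_sum_univ (φ : (I → ℝ) →ₗ[ℝ] ℝ) (T X)
    rw [map_sum]
    refine this.trans (Finset.sum_congr rfl fun g _ => ?_)
    rw [map_smul, smul_eq_mul, smul_eq_mul, mul_comm]
    rfl
  have hc : 0 < c := by
    have := hφ (T 0) (subset_closure ⟨0, h0, rfl⟩)
    rwa [hT0, map_zero] at this
  refine ⟨_, fun X hX => ?_, by rw [← hrep]; exact hc.trans hφZ⟩
  rw [← hrep]
  by_contra! hpos
  -- The multiple is chosen so that `φ` takes the value `c`, against the strict bound on the cone.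
  have h1 := hφ (T ((c / φ (T X)) • X))
    (subset_closure ⟨_, hcone _ (div_nonneg hc.le hpos.le) X hX, rfl⟩)
  have h2 := hTlin (c / φ (T X)) 0 X 0
  rw [smul_zero, add_zero, zero_smul, add_zero] at h2
  rw [h2, map_smul, smul_eq_mul, div_mul_cancel₀ _ hpos.ne'] at h1
  exact lt_irrefl _ h1

variable [IsProbabilityMeasure P]

/-- A uniformly bounded family in `L^∞` has a countable subfamily with the same essential
supremum. -/
theorem exists_seq_ae_le_iSup {𝒮 : Set (Lp ℝ ∞ P)} (hne : 𝒮.Nonempty) {M : ℝ}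
    (hM : ∀ Z ∈ 𝒮, ∀ᵐ ω ∂P, |Z ω| ≤ M) :
    ∃ Y : ℕ → Lp ℝ ∞ P, (∀ n, Y n ∈ 𝒮) ∧ ∀ Z ∈ 𝒮, ∀ᵐ ω ∂P, Z ω ≤ ⨆ n, Y n ω := by
  have hseqne : Nonempty (ℕ → 𝒮) := ⟨fun _ => ⟨hne.some, hne.some_mem⟩⟩
  let s : (ℕ → 𝒮) → Ω → ℝ := fun Y ω => ⨆ n, (Y n : Lp ℝ ∞ P) ω
  have hbd : ∀ Y : ℕ → 𝒮, ∀ᵐ ω ∂P, ∀ n, |(Y n : Lp ℝ ∞ P) ω| ≤ M :=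
    fun Y => ae_all_iff.2 fun n => hM _ (Y n).2
  have habove : ∀ Y : ℕ → 𝒮, ∀ᵐ ω ∂P, BddAbove (Set.range fun n => (Y n : Lp ℝ ∞ P) ω) := fun Y => by
    filter_upwards [hbd Y] with ω h
    exact ⟨M, by rintro _ ⟨n, rfl⟩; exact (abs_le.1 (h n)).2⟩
  have hsM : ∀ Y, ∀ᵐ ω ∂P, |s Y ω| ≤ M := fun Y => by
    filter_upwards [hbd Y, habove Y] with ω h h'
    exact abs_le.2 ⟨(abs_le.1 (h 0)).1.trans (le_ciSup h' 0), ciSup_le fun n => (abs_le.1 (h n)).2⟩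
  have hsint : ∀ Y, Integrable (s Y) P := fun Y =>
    Integrable.of_bound (AEMeasurable.iSup fun n =>
      (Lp.aestronglyMeasurable (Y n : Lp ℝ ∞ P)).aemeasurable).aestronglyMeasurable M (hsM Y)
  have hΦbdd : BddAbove (Set.range fun Y => ∫ ω, s Y ω ∂P) := ⟨M, by
    rintro _ ⟨Y, rfl⟩
    have := integral_mono_ae (hsint Y) (integrable_const M)
      ((hsM Y).mono fun ω h => (abs_le.1 h).2)
    simpa using this⟩
  -- The countable subfamily maximizes the integral of the pointwise supremum; merging near-optimal
  -- sequences through `Nat.unpair` attains `α`.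
  set α := ⨆ Y, ∫ ω, s Y ω ∂P with hα
  have hex : ∀ k : ℕ, ∃ Y, α - 1 / ((k : ℝ) + 1) < ∫ ω, s Y ω ∂P := fun k =>
    exists_lt_of_lt_ciSup (sub_lt_self _ (by positivity))
  choose Y hY using hex
  let W : ℕ → 𝒮 := fun n => Y n.unpair.1 n.unpair.2
  have hYW : ∀ k, ∀ᵐ ω ∂P, s (Y k) ω ≤ s W ω := fun k => by
    filter_upwards [habove W] with ω h
    refine ciSup_le fun n => ?_
    have := le_ciSup h (Nat.pair k n)
    simpa [W] using this
  have hW : α ≤ ∫ ω, s W ω ∂P := by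
    have h1 : ∀ k : ℕ, α - 1 / ((k : ℝ) + 1) ≤ ∫ ω, s W ω ∂P := fun k =>
      (hY k).le.trans (integral_mono_ae (hsint _) (hsint _) (hYW k))
    have h2 := (tendsto_one_div_add_atTop_nhds_zero_nat (𝕜 := ℝ)).const_sub α
    rw [sub_zero] at h2
    exact le_of_tendsto' h2 h1
  refine ⟨fun n => W n, fun n => (W n).2, fun Z hZ => ?_⟩
  -- Adjoining `Z` cannot raise the maximal integral, so the supremum is a.s. unchanged.
  let W' : ℕ → 𝒮 := fun n => Nat.casesOn n ⟨Z, hZ⟩ W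
  have hWW' : s W ≤ᵐ[P] s W' := by
    filter_upwards [habove W'] with ω h
    exact ciSup_le fun n => le_ciSup h (n + 1)
  have heq : s W =ᵐ[P] s W' := by
    refine (integral_eq_iff_of_ae_le (hsint _) (hsint _) hWW').1 (le_antisymm ?_ ?_)
    · exact integral_mono_ae (hsint _) (hsint _) hWW'
    · exact (le_ciSup hΦbdd W').trans hW
  filter_upwards [heq, habove W'] with ω h h'
  have h0 : Z ω ≤ s W' ω := le_ciSup h' 0
  rwa [← h] at h0

theorem pairing_ind {A : Set Ω} (hA : MeasurableSet A) (g : Lp ℝ 1 P) :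
    pairing (ind P hA) g = ∫ ω in A, g ω ∂P := by
  rw [pairing_apply, ← integral_indicator hA]
  refine integral_congr_ae ?_
  filter_upwards [coeFn_ind (P := P) hA] with ω h
  rw [h]
  by_cases hω : ω ∈ A <;> simp [hω]

/-- The Kreps–Yan theorem. -/
theorem exists_equivalent_measure {C : Set (Lp ℝ ∞ P)} (hconv : Convex ℝ C)
    (hneg : ∀ X ≤ 0, X ∈ C) (hcone : ∀ (r : ℝ), 0 ≤ r → ∀ X ∈ C, r • X ∈ C)
    (hC : @closure _ (weakStarTopology P) C ∩ {X : Lp ℝ ∞ P | 0 ≤ X} = {0}) :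
    ∃ Q : Measure Ω, IsProbabilityMeasure Q ∧ Q ≪ P ∧ P ≪ Q ∧ ∀ X ∈ C, ∫ ω, X ω ∂Q ≤ 0 := by
  set G : Set (Lp ℝ 1 P) := {g | ∀ X ∈ C, pairing X g ≤ 0} with hG
  have hGpos : ∀ g ∈ G, 0 ≤ g := by
    intro g hg
    rw [← Lp.coeFn_nonneg]
    refine ae_nonneg_of_forall_setIntegral_nonneg (L1.integrable_coeFn g) fun A hA _ => ?_
    have h1 := hg ((-1 : ℝ) • ind P hA + (0 : ℝ) • 0) (hneg _ (by
      rw [zero_smul, add_zero, neg_one_smul, neg_nonpos]; exact ind_nonneg hA))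
    rw [pairing_smul_add, pairing_ind] at h1
    linarith
  have hpos : ∀ g : Lp ℝ 1 P, MeasurableSet {ω | 0 < g ω} := fun g =>
    measurableSet_lt measurable_const (Lp.stronglyMeasurable g).measurable
  have hsep : ∀ A (hA : MeasurableSet A), P A ≠ 0 → ∃ g ∈ G, 0 < ∫ ω in A, g ω ∂P := by
    intro A hA hPA
    obtain ⟨g, hg, hgA⟩ := exists_pairing_pos hconv (hneg 0 le_rfl) hcone (Z := ind P hA) (by
      intro hmem
      have h1 : ind P hA ∈ ({0} : Set (Lp ℝ ∞ P)) := hC ▸ ⟨hmem, ind_nonneg hA⟩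
      rw [Set.mem_singleton_iff] at h1
      have h2 := coeFn_ind (P := P) hA
      rw [h1] at h2
      refine hPA (measure_eq_zero_iff_ae_notMem.2 ?_)
      filter_upwards [h2, Lp.coeFn_zero ℝ ∞ P] with ω a1 a2 hω
      rw [a2, Set.indicator_of_mem hω] at a1
      exact zero_ne_one a1)
    exact ⟨g, hg, by rwa [pairing_ind] at hgA⟩
  have h0G : (0 : Lp ℝ 1 P) ∈ G := fun X _ => by rw [map_zero]
  -- Countably many elements of `G` whose supports a.s. exhaust the supports of all the others.
  obtain ⟨Y, hYmem, hY⟩ := exists_seq_ae_le_iSup (𝒮 := (fun g => ind P (hpos g)) '' G) (M := 1)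
    ⟨_, 0, h0G, rfl⟩ (by
      rintro _ ⟨g, -, rfl⟩
      filter_upwards [coeFn_ind (P := P) (hpos g)] with ω h
      rw [h]
      by_cases hω : ω ∈ {ω | 0 < g ω} <;> simp only [Set.indicator_of_mem, hω,
        Set.indicator_of_notMem, not_false_eq_true] <;> norm_num)
  choose g hgG hgY using hYmem
  -- Positive weights, small enough for `∑ c n • g n` to converge absolutely in `L^1`.
  set c : ℕ → ℝ := fun n => (1 / 2) ^ n / (‖g n‖ + 1) with hc
  have hcpos : ∀ n, 0 < c n := fun n => by positivity
  have hsumm : Summable fun n => c n • g n := by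
    refine Summable.of_norm_bounded summable_geometric_two fun n => ?_
    rw [norm_smul, Real.norm_of_nonneg (hcpos n).le, hc, div_mul_eq_mul_div]
    rw [div_le_iff₀ (by positivity)]
    gcongr
    linarith
  set h : Lp ℝ 1 P := ∑' n, c n • g n with hh
  have hterm : ∀ n, 0 ≤ c n • g n := fun n => by
    rw [← Lp.coeFn_nonneg]
    filter_upwards [Lp.coeFn_smul (c n) (g n), (Lp.coeFn_nonneg _).2 (hGpos _ (hgG n))]
      with ω a1 a2
    rw [a1]
    exact mul_nonneg (hcpos n).le a2
  have hle : ∀ n, c n • g n ≤ h := fun n => hsumm.le_tsum n fun k _ => hterm k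
  have hhG : h ∈ G := fun X hX => by
    rw [hh, (pairing X).map_tsum hsumm]
    refine tsum_nonpos fun n => ?_
    rw [map_smul]
    exact mul_nonpos_of_nonneg_of_nonpos (hcpos n).le (hgG n X hX)
  -- If `h` were not positive on a nonnull set, separation would give `k ∈ G` with positive integral
  -- there. But all `g n` are nonpositive off the support of `h`, and by maximality `k` vanishes
  -- there too.
  have hhpos : ∀ᵐ ω ∂P, 0 < h ω := by
    by_contra hcon
    have hA : MeasurableSet {ω | 0 < h ω}ᶜ := (hpos h).compl
    obtain ⟨k, hk, hkA⟩ := hsep _ hA hcon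
    have hzero : ∀ᵐ ω ∂P, ω ∈ {ω | 0 < h ω}ᶜ → k ω = 0 := by
      filter_upwards [hY _ ⟨k, hk, rfl⟩, coeFn_ind (P := P) (hpos k), ae_all_iff.2 fun n =>
        coeFn_ind (P := P) (hpos (g n)), ae_all_iff.2 fun n => (Lp.coeFn_le _ _).2 (hle n),
        ae_all_iff.2 fun n => Lp.coeFn_smul (c n) (g n), (Lp.coeFn_nonneg _).2 (hGpos k hk)]
        with ω a1 a2 a3 a4 a5 a6 hω
      have hgn : ∀ n, ¬ 0 < g n ω := fun n hn => by
        refine hω (lt_of_lt_of_le ?_ (a4 n))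
        rw [a5]
        exact mul_pos (hcpos n) hn
      have h1 : (⨆ n, Y n ω) = 0 := by
        have : ∀ n, Y n ω = 0 := fun n => by
          rw [← hgY n, a3 n]
          exact Set.indicator_of_notMem (s := {ω | 0 < g n ω}) (hgn n) fun _ => (1 : ℝ)
        simp [this]
      rw [h1, a2] at a1
      by_contra hne
      have hkpos : ω ∈ {ω | 0 < k ω} := lt_of_le_of_ne (show (0 : ℝ) ≤ k ω from a6) (Ne.symm hne)
      rw [Set.indicator_of_mem hkpos] at a1
      linarith
    rw [setIntegral_congr_ae (g := fun _ => (0 : ℝ)) hA hzero] at hkA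
    simp at hkA
  have hint := L1.integrable_coeFn h
  set b := ∫ ω, h ω ∂P with hb
  have hbpos : 0 < b := by
    refine lt_of_le_of_ne (integral_nonneg_of_ae (hhpos.mono fun ω hω => hω.le)) fun h0 => ?_
    have h1 := (integral_eq_zero_iff_of_nonneg_ae (hhpos.mono fun ω hω => hω.le) hint).1 h0.symm
    obtain ⟨ω, h2, h3⟩ := (h1.and hhpos).exists
    exact h3.ne' h2
  have hdm : Measurable fun ω => ENNReal.ofReal (b⁻¹ * h ω) :=
    ((Lp.stronglyMeasurable h).measurable.const_mul _).ennreal_ofReal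
  refine ⟨P.withDensity fun ω => ENNReal.ofReal (b⁻¹ * h ω), ⟨?_⟩,
    withDensity_absolutelyContinuous _ _, withDensity_absolutelyContinuous' hdm.aemeasurable ?_,
    fun X hX => ?_⟩
  · rw [withDensity_apply _ MeasurableSet.univ, Measure.restrict_univ,
      ← ofReal_integral_eq_lintegral_ofReal (hint.const_mul _), integral_const_mul, ← hb,
      inv_mul_cancel₀ hbpos.ne', ENNReal.ofReal_one]
    filter_upwards [hhpos] with ω hω
    exact mul_nonneg (inv_nonneg.2 hbpos.le) hω.le
  · filter_upwards [hhpos] with ω hω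
    exact (ENNReal.ofReal_pos.2 (mul_pos (inv_pos.2 hbpos) hω)).ne'
  · rw [integral_withDensity_eq_integral_toReal_smul hdm
      (Eventually.of_forall fun _ => ENNReal.ofReal_lt_top)]
    have h1 : ∫ ω, (ENNReal.ofReal (b⁻¹ * h ω)).toReal • X ω ∂P = b⁻¹ * pairing X h := by
      rw [pairing_apply, ← integral_const_mul]
      refine integral_congr_ae ?_
      filter_upwards [hhpos] with ω hω
      rw [ENNReal.toReal_ofReal (mul_nonneg (inv_nonneg.2 hbpos.le) hω.le), smul_eq_mul]
      ring
    rw [h1]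
    exact mul_nonpos_of_nonneg_of_nonpos (inv_nonneg.2 hbpos.le) (hhG X hX)

end KrepsYan

/-! ### The initial price as a convex functional, and locality of the conditional prices. -/

section Pricing

variable {Ω : Type*} {m : MeasurableSpace Ω} {𝓕 : Filtration ℝ≥0 m} {P : Measure Ω}

theorem StopTime.sigma_le (τ : StopTime 𝓕) : τ.sigma ≤ m := fun _ hA => hA.1

theorem exists_Linf_ae_eq (τ : StopTime 𝓕) {f : Ω → ℝ} (hf : AEStronglyMeasurable[τ.sigma] f P)
    {C : ℝ} (hC : ∀ᵐ ω ∂P, |f ω| ≤ C) : ∃ Y : Linf P τ, (Y : Lp ℝ ∞ P) =ᵐ[P] f := by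
  obtain ⟨Y, hY⟩ := exists_Linfty_ae_eq (hf.mono τ.sigma_le) hC
  exact ⟨⟨Y, mem_lpMeas_iff_aestronglyMeasurable.2 (hf.congr hY.symm)⟩, hY⟩

theorem mem_Linf_infty (X : Lp ℝ ∞ P) : X ∈ Linf P (StopTime.infty 𝓕) := by
  rw [mem_lpMeas_iff_aestronglyMeasurable]
  have h : m ≤ (StopTime.infty 𝓕).sigma := fun A hA => ⟨hA, fun t => by
    have : {ω : Ω | (StopTime.infty 𝓕).1 ω ≤ (t : WithTop ℝ≥0)} = ∅ := by
      ext ω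
      simp only [StopTime.infty, Set.mem_ofPred_eq, top_le_iff, WithTop.coe_ne_top,
        Set.mem_empty_iff_false]
    rw [this, Set.inter_empty]
    exact @MeasurableSet.empty _ (𝓕 t)⟩
  exact (Lp.aestronglyMeasurable X).mono h

theorem const_mem_Linf [IsFiniteMeasure P] (τ : StopTime 𝓕) (c : ℝ) :
    Lp.const ∞ P c ∈ Linf P τ := by
  rw [mem_lpMeas_iff_aestronglyMeasurable]
  exact (aestronglyMeasurable_const (b := c)).congr (Lp.coeFn_const (p := ∞) P c).symm

/-- The null sets and their complements are closed under the operations that generate `𝓕_0`. -/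
theorem UsualConditions.measure_eq_zero_or (h𝓕 : UsualConditions 𝓕 P) {A : Set Ω}
    (hA : MeasurableSet[(StopTime.zero 𝓕).sigma] A) : P A = 0 ∨ P Aᶜ = 0 := by
  have h0 : MeasurableSet[𝓕 0] A := by
    have h1 := hA.2 0
    have h2 : {ω : Ω | (StopTime.zero 𝓕).1 ω ≤ ((0 : ℝ≥0) : WithTop ℝ≥0)} = Set.univ := by
      ext ω
      simp [StopTime.zero]
    rwa [h2, Set.inter_univ] at h1
  rw [h𝓕.initial] at h0
  clear hA
  induction h0 with
  | basic B hB => exact Or.inl hB.2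
  | empty => exact Or.inl measure_empty
  | compl B _ ih => rw [compl_compl]; exact ih.symm
  | iUnion B _ ih =>
    by_cases h : ∀ n, P (B n) = 0
    · exact Or.inl (measure_iUnion_null h)
    · push Not at h
      obtain ⟨n, hn⟩ := h
      refine Or.inr (measure_mono_null ?_ ((ih n).resolve_left hn))
      exact Set.compl_subset_compl.2 (Set.subset_iUnion B n)

/-- Since `𝓕_0` is trivial, the elements of `L^∞(𝓕_0)` are constants. -/
theorem UsualConditions.eq_const [IsProbabilityMeasure P] (h𝓕 : UsualConditions 𝓕 P)
    (Z : Linf P (StopTime.zero 𝓕)) :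
    (Z : Lp ℝ ∞ P) = Lp.const ∞ P (∫ ω, (Z : Lp ℝ ∞ P) ω ∂P) := by
  obtain ⟨f, hf, hZf⟩ := lpMeas.aestronglyMeasurable Z
  set c := ∫ ω, (Z : Lp ℝ ∞ P) ω ∂P with hc
  have hfint : Integrable f P := (Linfty_integrable (Z : Lp ℝ ∞ P)).congr hZf
  have hcf : ∫ ω, f ω ∂P = c := (integral_congr_ae hZf).symm
  have hA : MeasurableSet[(StopTime.zero 𝓕).sigma] {ω | f ω < c} :=
    hf.measurable measurableSet_Iio
  have hfc : f =ᵐ[P] fun _ => c := by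
    rcases h𝓕.measure_eq_zero_or hA with h | h
    · have h1 : (fun _ => c) ≤ᵐ[P] f := by
        filter_upwards [measure_eq_zero_iff_ae_notMem.1 h] with ω hω
        exact not_lt.1 hω
      refine ((integral_eq_iff_of_ae_le (integrable_const c) hfint h1).1 ?_).symm
      simp [hcf]
    · have h1 : ∀ᵐ ω ∂P, f ω < c := h
      have h2 : f =ᵐ[P] fun _ => c := by
        refine (integral_eq_iff_of_ae_le hfint (integrable_const c) (h1.mono fun _ h => h.le)).1 ?_
        simp [hcf]
      obtain ⟨ω, h3, h4⟩ := (h1.and h2).exists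
      exact absurd h4 h3.ne
  refine Lp.ext ?_
  filter_upwards [hZf, hfc, Lp.coeFn_const (p := ∞) P c] with ω h1 h2 h3
  rw [h1, h2, h3]; rfl

variable (Φ : PricingProcedure 𝓕 P)

namespace PricingProcedure

/-- The zero position is the midpoint of `X` and `-X`, so convexity and normalization give the
inequality. -/
theorem bid_le_ask {σ τ : StopTime 𝓕} (h : σ ≤ τ) (X : Linf P τ) :
    -(Φ.price h (-X) : Lp ℝ ∞ P) ≤ (Φ.price h X : Lp ℝ ∞ P) := by
  have h1 := Φ.convex h X (-X) (1 / 2) (by norm_num) (by norm_num)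
  have h2 : (1 / 2 : ℝ) • X + (1 - 1 / 2 : ℝ) • (-X) = 0 := by module
  rw [h2, Φ.normalized] at h1
  have h3 : (0 : Lp ℝ ∞ P) ≤ (1 / 2 : ℝ) • (Φ.price h X : Lp ℝ ∞ P)
    + (1 - 1 / 2 : ℝ) • (Φ.price h (-X) : Lp ℝ ∞ P) := h1
  have h4 := Linfty_smul_nonneg (show (0 : ℝ) ≤ 2 by norm_num) h3
  have h5 : (2 : ℝ) • ((1 / 2 : ℝ) • (Φ.price h X : Lp ℝ ∞ P)
    + (1 - 1 / 2 : ℝ) • (Φ.price h (-X) : Lp ℝ ∞ P))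
      = (Φ.price h X : Lp ℝ ∞ P) - -(Φ.price h (-X) : Lp ℝ ∞ P) := by module
  rw [h5] at h4
  exact sub_nonneg.1 h4

/-- The price at time `0`, as a real number. -/
noncomputable def initialPrice (X : Lp ℝ ∞ P) : ℝ :=
  ∫ ω, (Φ.price (StopTime.zero_le (StopTime.infty 𝓕)) ⟨X, mem_Linf_infty X⟩ : Lp ℝ ∞ P) ω ∂P

variable {Φ}

/-- An `𝓕_τ`-measurable position is its own price at `τ`, by translation invariance and
normalization; time consistency then removes the maturity. This is why the single functional
`initialPrice` suffices. -/
theorem price_zero_eq (hPi : Φ.IsTCPP) {τ : StopTime 𝓕} (X : Linf P τ) :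
    Φ.price (StopTime.zero_le τ) X
      = Φ.price (StopTime.zero_le (StopTime.infty 𝓕)) ⟨X, mem_Linf_infty (X : Lp ℝ ∞ P)⟩ := by
  have h1 := hPi.timeConsistent (StopTime.zero_le τ) τ.le_infty
    ⟨X, mem_Linf_infty (X : Lp ℝ ∞ P)⟩
  have h2 : Φ.price τ.le_infty ⟨X, mem_Linf_infty (X : Lp ℝ ∞ P)⟩ = X := by
    have h := Φ.translation τ.le_infty X 0
    rw [Φ.normalized, zero_add, zero_add] at h
    exact h
  rw [h2] at h1
  exact h1

theorem initialPrice_price (hPi : Φ.IsTCPP) {σ τ : StopTime 𝓕} (h : σ ≤ τ) (X : Linf P τ) :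
    Φ.initialPrice (Φ.price h X : Lp ℝ ∞ P) = Φ.initialPrice (X : Lp ℝ ∞ P) := by
  unfold initialPrice
  rw [← price_zero_eq hPi X, ← price_zero_eq hPi (Φ.price h X), hPi.timeConsistent]

theorem price_zero_eq_const [IsProbabilityMeasure P] (h𝓕 : UsualConditions 𝓕 P) (hPi : Φ.IsTCPP)
    {τ : StopTime 𝓕} (X : Linf P τ) : (Φ.price (StopTime.zero_le τ) X : Lp ℝ ∞ P)
      = Lp.const ∞ P (Φ.initialPrice (X : Lp ℝ ∞ P)) := by
  rw [h𝓕.eq_const (Φ.price (StopTime.zero_le τ) X), price_zero_eq hPi X]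
  rfl

theorem isConvexPrice_initialPrice [IsProbabilityMeasure P] (h𝓕 : UsualConditions 𝓕 P)
    (hPi : Φ.IsTCPP) : IsConvexPrice P Φ.initialPrice where
  mono X Y h := by
    refine integral_mono_ae (Linfty_integrable _) (Linfty_integrable _) ?_
    exact (Lp.coeFn_le _ _).2 (Φ.monotone _ _ _ h)
  cash X c := by
    have h1 := Φ.translation (StopTime.zero_le (StopTime.infty 𝓕))
      ⟨Lp.const ∞ P c, const_mem_Linf _ c⟩ ⟨X, mem_Linf_infty X⟩
    have h2 : (Φ.price (StopTime.zero_le (StopTime.infty 𝓕))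
        ⟨X + Lp.const ∞ P c, mem_Linf_infty _⟩ : Lp ℝ ∞ P)
        = (Φ.price (StopTime.zero_le (StopTime.infty 𝓕)) ⟨X, mem_Linf_infty X⟩ : Lp ℝ ∞ P)
          + Lp.const ∞ P c := congrArg Subtype.val h1
    unfold initialPrice
    rw [h2]
    rw [integral_congr_ae (Lp.coeFn_add _ _)]
    simp only [Pi.add_apply]
    rw [integral_add (Linfty_integrable _) (Linfty_integrable _),
      integral_congr_ae (Lp.coeFn_const (p := ∞) P c)]
    simp
  convex X Y r h0 h1 := by
    have h2 := Φ.convex (StopTime.zero_le (StopTime.infty 𝓕))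
      ⟨X, mem_Linf_infty X⟩ ⟨Y, mem_Linf_infty Y⟩ r h0 h1
    unfold initialPrice
    rw [← integral_const_mul, ← integral_const_mul, ← integral_add
      ((Linfty_integrable _).const_mul r) ((Linfty_integrable _).const_mul (1 - r))]
    refine integral_mono_ae (Linfty_integrable _) (((Linfty_integrable _).const_mul r).add
      ((Linfty_integrable _).const_mul (1 - r))) ?_
    set p := Φ.price (StopTime.zero_le (StopTime.infty 𝓕)) ⟨X, mem_Linf_infty X⟩
    set q := Φ.price (StopTime.zero_le (StopTime.infty 𝓕)) ⟨Y, mem_Linf_infty Y⟩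
    filter_upwards [(Lp.coeFn_le _ _).2 (show (_ : Lp ℝ ∞ P) ≤ r • (p : Lp ℝ ∞ P)
      + (1 - r) • (q : Lp ℝ ∞ P) from h2), Lp.coeFn_add (r • (p : Lp ℝ ∞ P)) ((1 - r) • q),
      Lp.coeFn_smul r (p : Lp ℝ ∞ P), Lp.coeFn_smul (1 - r) (q : Lp ℝ ∞ P)] with ω a1 a2 a3 a4
    rw [a2, Pi.add_apply, a3, a4] at a1
    exact a1
  zero := by
    have h1 := Φ.normalized (StopTime.zero_le (StopTime.infty 𝓕))
    have h2 : (Φ.price (StopTime.zero_le (StopTime.infty 𝓕)) ⟨0, mem_Linf_infty 0⟩ : Lp ℝ ∞ P)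
      = 0 := congrArg Subtype.val h1
    unfold initialPrice
    rw [h2, integral_congr_ae (Lp.coeFn_zero ℝ ∞ P)]
    simp
  below X Y hmono hlim := by
    have h1 := hPi.continuousFromBelow (StopTime.zero_le (StopTime.infty 𝓕))
      (fun n => ⟨X n, mem_Linf_infty _⟩) ⟨Y, mem_Linf_infty _⟩ (fun i j hij => hmono hij) hlim
    have h2 : ∀ Z : Lp ℝ ∞ P, ∀ᵐ ω ∂P, (Φ.price (StopTime.zero_le (StopTime.infty 𝓕))
        ⟨Z, mem_Linf_infty Z⟩ : Lp ℝ ∞ P) ω = Φ.initialPrice Z := fun Z => by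
      rw [price_zero_eq_const h𝓕 hPi]
      exact Lp.coeFn_const (p := ∞) P _
    obtain ⟨ω, a1, a2, a3⟩ := (h1.and ((ae_all_iff.2 fun n => h2 (X n)).and (h2 Y))).exists
    simp only [a2, a3] at a1
    exact a1

/-- Locality: on an event `A ∈ 𝓕_σ` the price at time `σ` only depends on the position on `A`. -/
theorem price_indicator (Φ : PricingProcedure 𝓕 P) [IsProbabilityMeasure P]
    {σ τ : StopTime 𝓕} (h : σ ≤ τ) {A : Set Ω}
    (hA : MeasurableSet[σ.sigma] A) {X W : Linf P τ}
    (hW : (W : Lp ℝ ∞ P) =ᵐ[P] A.indicator (X : Lp ℝ ∞ P)) :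
    (Φ.price h W : Lp ℝ ∞ P) =ᵐ[P] A.indicator (Φ.price h X : Lp ℝ ∞ P) := by
  obtain ⟨M, hM0, hM⟩ := Linfty_exists_bound (X : Lp ℝ ∞ P)
  have hind : ∀ B : Set Ω, MeasurableSet[σ.sigma] B →
      ∃ Z : Linf P σ, (Z : Lp ℝ ∞ P) =ᵐ[P] B.indicator fun _ => M := fun B hB =>
    exists_Linf_ae_eq σ (C := M) ((@stronglyMeasurable_const _ _ σ.sigma _ M).indicator
      hB).aestronglyMeasurable (Eventually.of_forall fun ω => by
        by_cases hω : ω ∈ B <;> simp [hω, abs_of_nonneg hM0, hM0])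
  have hcmp : ∀ (V V' : Linf P τ) (Z : Linf P σ),
      (∀ᵐ ω ∂P, (V : Lp ℝ ∞ P) ω ≤ (V' : Lp ℝ ∞ P) ω + (Z : Lp ℝ ∞ P) ω) →
      ∀ᵐ ω ∂P, (Φ.price h V : Lp ℝ ∞ P) ω ≤ (Φ.price h V' : Lp ℝ ∞ P) ω + (Z : Lp ℝ ∞ P) ω := by
    intro V V' Z hV
    have h1 : V ≤ V' + Linf.incl h Z := by
      change (V : Lp ℝ ∞ P) ≤ (V' : Lp ℝ ∞ P) + (Z : Lp ℝ ∞ P)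
      rw [← Lp.coeFn_le]
      filter_upwards [hV, Lp.coeFn_add (V' : Lp ℝ ∞ P) (Z : Lp ℝ ∞ P)] with ω a1 a2
      rw [a2]; exact a1
    have h2 := Φ.monotone h _ _ h1
    rw [Φ.translation] at h2
    have h3 : (Φ.price h V : Lp ℝ ∞ P) ≤ (Φ.price h V' : Lp ℝ ∞ P) + (Z : Lp ℝ ∞ P) := h2
    filter_upwards [(Lp.coeFn_le _ _).2 h3,
      Lp.coeFn_add (Φ.price h V' : Lp ℝ ∞ P) (Z : Lp ℝ ∞ P)] with ω a1 a2
    rw [a2] at a1; exact a1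
  obtain ⟨Z, hZ⟩ := hind Aᶜ hA.compl
  obtain ⟨Z', hZ'⟩ := hind A hA
  have hzero : ∀ᵐ ω ∂P, ((0 : Linf P τ) : Lp ℝ ∞ P) ω = 0 := Lp.coeFn_zero ℝ ∞ P
  have hpzero : ∀ᵐ ω ∂P, (Φ.price h 0 : Lp ℝ ∞ P) ω = 0 := by
    rw [Φ.normalized]; exact Lp.coeFn_zero ℝ ∞ P
  -- `X` and `W` differ by at most `M` and only off `A`, so their prices agree on `A`; `c3` and `c4`
  -- likewise compare `W` with `0` and settle the complement.
  have c1 := hcmp X W Z (by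
    filter_upwards [hW, hM, hZ] with ω a1 a2 a3
    rw [a1, a3]
    by_cases hω : ω ∈ A
    · simp [hω]
    · simpa [hω] using (abs_le.1 a2).2)
  have c2 := hcmp W X Z (by
    filter_upwards [hW, hM, hZ] with ω a1 a2 a3
    rw [a1, a3]
    by_cases hω : ω ∈ A
    · simp [hω]
    · simp only [Set.indicator_of_notMem hω, Set.indicator_of_mem (Set.mem_compl hω)]
      linarith [(abs_le.1 a2).1])
  have c3 := hcmp W 0 Z' (by
    filter_upwards [hW, hM, hZ', hzero] with ω a1 a2 a3 a4
    rw [a1, a3, a4]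
    by_cases hω : ω ∈ A
    · simpa [hω] using (abs_le.1 a2).2
    · simp [hω])
  have c4 := hcmp 0 W Z' (by
    filter_upwards [hW, hM, hZ', hzero] with ω a1 a2 a3 a4
    rw [a1, a3, a4]
    by_cases hω : ω ∈ A
    · simp only [Set.indicator_of_mem hω]
      linarith [(abs_le.1 a2).1]
    · simp [hω])
  filter_upwards [c1, c2, c3, c4, hZ, hZ', hpzero] with ω a1 a2 a3 a4 a5 a6 a7
  rw [a5] at a1 a2
  rw [a6, a7] at a3 a4
  by_cases hω : ω ∈ A
  · simp only [Set.indicator_of_mem hω,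
      Set.indicator_of_notMem (Set.notMem_compl_iff.2 hω), add_zero] at a1 a2 ⊢
    exact le_antisymm a2 a1
  · simp only [Set.indicator_of_notMem hω, add_zero] at a3 a4 ⊢
    exact le_antisymm a3 a4

/-- Locality applied to `X - Z`, with `Z` pulled out by translation invariance. -/
theorem price_indicator_sub (Φ : PricingProcedure 𝓕 P) [IsProbabilityMeasure P]
    {σ τ : StopTime 𝓕} (h : σ ≤ τ) {A : Set Ω}
    (hA : MeasurableSet[σ.sigma] A) {X W : Linf P τ} {Z : Linf P σ}
    (hW : (W : Lp ℝ ∞ P) =ᵐ[P]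
      A.indicator fun ω => (X : Lp ℝ ∞ P) ω - (Z : Lp ℝ ∞ P) ω) :
    (Φ.price h W : Lp ℝ ∞ P) =ᵐ[P]
      A.indicator fun ω => (Φ.price h X : Lp ℝ ∞ P) ω - (Z : Lp ℝ ∞ P) ω := by
  have h1 := price_indicator Φ h hA (X := X + Linf.incl h (-Z)) (W := W) (by
    filter_upwards [hW, Lp.coeFn_add (X : Lp ℝ ∞ P) (-(Z : Lp ℝ ∞ P)),
      Lp.coeFn_neg (Z : Lp ℝ ∞ P)] with ω a1 a2 a3
    rw [a1]
    by_cases hω : ω ∈ A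
    · rw [Set.indicator_of_mem hω, Set.indicator_of_mem hω]
      change _ = ((X : Lp ℝ ∞ P) + (-(Z : Lp ℝ ∞ P)) : Lp ℝ ∞ P) ω
      rw [a2, Pi.add_apply, a3, Pi.neg_apply, sub_eq_add_neg]
    · rw [Set.indicator_of_notMem hω, Set.indicator_of_notMem hω])
  rw [Φ.translation] at h1
  filter_upwards [h1, Lp.coeFn_add (Φ.price h X : Lp ℝ ∞ P) (-(Z : Lp ℝ ∞ P)),
    Lp.coeFn_neg (Z : Lp ℝ ∞ P)] with ω a1 a2 a3
  rw [a1]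
  by_cases hω : ω ∈ A
  · rw [Set.indicator_of_mem hω, Set.indicator_of_mem hω]
    change ((Φ.price h X : Lp ℝ ∞ P) + (-(Z : Lp ℝ ∞ P)) : Lp ℝ ∞ P) ω = _
    rw [a2, Pi.add_apply, a3, Pi.neg_apply, sub_eq_add_neg]
  · rw [Set.indicator_of_notMem hω, Set.indicator_of_notMem hω]

end PricingProcedure

end Pricing

/-! ### Finite-penalty measures are martingale measures, and they dominate prices. -/

section MartingaleMeasures

variable {Ω : Type*} {m : MeasurableSpace Ω} {𝓕 : Filtration ℝ≥0 m} {P : Measure Ω}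
  {d : ℕ} {S : Fin (d + 1) → ℝ≥0 → Ω → ℝ} {Φ : PricingProcedure 𝓕 P}

theorem exists_Linf_indicator_sub {σ τ : StopTime 𝓕} (h : σ ≤ τ) {A : Set Ω}
    (hA : MeasurableSet[σ.sigma] A) (X : Linf P τ) (Z : Linf P σ) : ∃ W : Linf P τ,
      (W : Lp ℝ ∞ P) =ᵐ[P] A.indicator fun ω => (X : Lp ℝ ∞ P) ω - (Z : Lp ℝ ∞ P) ω := by
  obtain ⟨M, hM0, hM⟩ := Linfty_exists_bound ((X - Linf.incl h Z : Linf P τ) : Lp ℝ ∞ P)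
  obtain ⟨f, hf, hXf⟩ := lpMeas.aestronglyMeasurable (X - Linf.incl h Z)
  obtain ⟨W, hW⟩ := exists_Linf_ae_eq (P := P) τ (C := M)
    (hf.indicator (StopTime.sigma_mono h A hA)).aestronglyMeasurable (by
    filter_upwards [hM, hXf] with ω h1 h2
    rw [h2] at h1
    by_cases hω : ω ∈ A
    · rwa [Set.indicator_of_mem hω]
    · rwa [Set.indicator_of_notMem hω, abs_zero])
  refine ⟨W, ?_⟩
  filter_upwards [hW, hXf, Lp.coeFn_sub (X : Lp ℝ ∞ P) (Z : Lp ℝ ∞ P)] with ω h1 h2 h3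
  rw [h1]
  by_cases hω : ω ∈ A
  · rw [Set.indicator_of_mem hω, Set.indicator_of_mem hω, ← h2]; exact h3
  · rw [Set.indicator_of_notMem hω, Set.indicator_of_notMem hω]

theorem abs_condExp_le {Q : Measure Ω} (hQP : Q ≪ P) (hPQ : P ≪ Q)
    (σ : StopTime 𝓕) {X : Lp ℝ ∞ P} {M : ℝ} (hM : ∀ᵐ ω ∂P, |X ω| ≤ M) :
    ∀ᵐ ω ∂P, |condExp σ.sigma Q X ω| ≤ M :=
  hPQ.ae_le (ae_bdd_abs_condExp_of_ae_bdd_abs (hQP.ae_le hM))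

/-- This turns the essential infimum for `X` into an essential supremum for `-X`. -/
theorem condPrices_neg (σ : StopTime 𝓕) (X : Lp ℝ ∞ P) :
    condPrices P S σ (-X) = -condPrices P S σ X := by
  have key : ∀ X Y : Lp ℝ ∞ P, Y ∈ condPrices P S σ X → -Y ∈ condPrices P S σ (-X) := by
    rintro X Y ⟨Q, hQmem, hY⟩
    obtain ⟨hQ, hQP, hPQ, -⟩ := id hQmem
    refine ⟨Q, hQmem, ?_⟩
    have h1 : condExp σ.sigma Q (-X : Lp ℝ ∞ P) =ᵐ[Q] -condExp σ.sigma Q X :=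
      (condExp_congr_ae (hQP.ae_le (Lp.coeFn_neg X))).trans (condExp_neg _ _)
    filter_upwards [Lp.coeFn_neg Y, hY, hPQ.ae_le h1] with ω a1 a2 a3
    rw [a1, a3, Pi.neg_apply, Pi.neg_apply, a2]
  ext Y
  rw [Set.mem_neg]
  exact ⟨fun h => by simpa using key _ _ h, fun h => by simpa using key _ _ h⟩

variable [IsProbabilityMeasure P]

/-- An equivalent probability measure with finite penalty is a local martingale measure. -/
theorem mem_ELMM_of_integral_le (h𝓕 : UsualConditions 𝓕 P) (hΦ : Φ.IsTCPP)
    (hext : Φ.ExtendsDynamics S) {Q : Measure Ω} [IsProbabilityMeasure Q] (hQP : Q ≪ P)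
    (hPQ : P ≪ Q) {c : ℝ} (hQ : ∀ Y : Lp ℝ ∞ P, ∫ ω, Y ω ∂Q ≤ Φ.initialPrice Y + c) :
    Q ∈ ELMM 𝓕 P S := by
  refine ⟨inferInstance, hQP, hPQ, fun k σ τ h hb => ?_⟩
  obtain ⟨Y, hY⟩ := hb.2
  set Z := Φ.price h Y
  have hZ : (Z : Lp ℝ ∞ P) =ᵐ[P] stoppedValue (S k) σ.1 := by
    have h1 := hext k 1 h hb Y (by filter_upwards [hY] with ω h1; simp [h1])
    filter_upwards [h1] with ω h1
    simpa using h1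
  have hYint : Integrable (Y : Lp ℝ ∞ P) Q := Linfty_integrable_of_ac hQP _
  have hZint : Integrable (Z : Lp ℝ ∞ P) Q := Linfty_integrable_of_ac hQP _
  have key : ∀ A, MeasurableSet[σ.sigma] A →
      ∫ ω in A, ((Y : Lp ℝ ∞ P) ω - (Z : Lp ℝ ∞ P) ω) ∂Q = 0 := by
    intro A hA
    set x := ∫ ω in A, ((Y : Lp ℝ ∞ P) ω - (Z : Lp ℝ ∞ P) ω) ∂Q with hx
    have hn : ∀ n : ℤ, (n : ℝ) * x ≤ c := by
      intro n
      have hnY : (((n : ℝ) • Y : Linf P τ) : Lp ℝ ∞ P) =ᵐ[P]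
          fun ω => (n : ℝ) * (Y : Lp ℝ ∞ P) ω := Lp.coeFn_smul (n : ℝ) (Y : Lp ℝ ∞ P)
      have hnZ : (((n : ℝ) • Z : Linf P σ) : Lp ℝ ∞ P) =ᵐ[P]
          fun ω => (n : ℝ) * (Z : Lp ℝ ∞ P) ω := Lp.coeFn_smul (n : ℝ) (Z : Lp ℝ ∞ P)
      have hprice := hext k n h hb ((n : ℝ) • Y) (by
        filter_upwards [hnY, hY] with ω h1 h2
        rw [h1, h2])
      obtain ⟨W, hW'⟩ := exists_Linf_indicator_sub h hA ((n : ℝ) • Y) ((n : ℝ) • Z)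
      -- At time `σ` the position `n 1_A (S_τ - S_σ)` costs zero: the price of `n S_τ` is exactly `n
      -- S_σ`.
      have hpW : (Φ.price h W : Lp ℝ ∞ P) = 0 := by
        refine Lp.ext ?_
        filter_upwards [PricingProcedure.price_indicator_sub Φ h hA hW', hprice, hnZ, hZ,
          Lp.coeFn_zero ℝ ∞ P] with ω h1 h2 h3 h4 h5
        rw [h1, h5]
        by_cases hω : ω ∈ A
        · rw [Set.indicator_of_mem hω, h2, h3, h4, sub_self]; rfl
        · rw [Set.indicator_of_notMem hω]; rfl
      have h1 := hQ (W : Lp ℝ ∞ P)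
      rw [← PricingProcedure.initialPrice_price hΦ h W, hpW,
        (PricingProcedure.isConvexPrice_initialPrice h𝓕 hΦ).zero, zero_add] at h1
      have h2 : ∫ ω, (W : Lp ℝ ∞ P) ω ∂Q = n * x := by
        rw [hx, ← integral_const_mul, ← integral_indicator (σ.sigma_le A hA)]
        refine integral_congr_ae (hQP.ae_le ?_)
        filter_upwards [hW', hnY, hnZ] with ω h1 h2 h3
        rw [h1]
        by_cases hω : ω ∈ A
        · rw [Set.indicator_of_mem hω, Set.indicator_of_mem hω, h2, h3, mul_sub]
        · rw [Set.indicator_of_notMem hω, Set.indicator_of_notMem hω]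
      rwa [h2] at h1
    by_contra hne
    obtain ⟨N, hN⟩ := exists_int_gt (c / |x|)
    rw [div_lt_iff₀ (abs_pos.2 hne)] at hN
    rcases abs_choice x with hx' | hx' <;> rw [hx'] at hN
    · exact absurd (hn N) (not_le.2 hN)
    · have := hn (-N)
      push_cast at this
      linarith
  refine (ae_eq_condExp_of_forall_setIntegral_eq σ.sigma_le
    (hYint.congr (hQP.ae_le hY)) (fun A _ _ => (hZint.congr (hQP.ae_le hZ)).integrableOn)
    (fun A hA _ => ?_) ?_).symm
  · rw [← setIntegral_congr_ae (σ.sigma_le A hA) (Filter.Eventually.mono (hQP.ae_le hZ) fun ω h _ => h),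
      ← setIntegral_congr_ae (σ.sigma_le A hA) (Filter.Eventually.mono (hQP.ae_le hY) fun ω h _ => h)]
    have := key A hA
    rw [integral_sub hYint.integrableOn hZint.integrableOn] at this
    linarith
  · exact ((lpMeas.aestronglyMeasurable Z).congr hZ).mono_ac hQP

/-- Under No Free Lunch, some equivalent probability measure has zero penalty. -/
theorem exists_measure_integral_le_initialPrice (h𝓕 : UsualConditions 𝓕 P) (hΦ : Φ.IsTCPP)
    (hNFL : Φ.NoFreeLunch) : ∃ Q : Measure Ω, IsProbabilityMeasure Q ∧ Q ≪ P ∧ P ≪ Q ∧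
      ∀ Y : Lp ℝ ∞ P, ∫ ω, Y ω ∂Q ≤ Φ.initialPrice Y := by
  have hρ := PricingProcedure.isConvexPrice_initialPrice h𝓕 hΦ
  have hmem : ∀ Y, Y ∈ Φ.zeroCostCone ↔ ∃ (r : ℝ) (X : Lp ℝ ∞ P), 0 ≤ r ∧
      Φ.initialPrice X ≤ 0 ∧ Y = r • X := by
    have hle : ∀ X : Linf P (StopTime.infty 𝓕),
        Φ.price (StopTime.zero_le (StopTime.infty 𝓕)) X ≤ 0
          ↔ Φ.initialPrice (X : Lp ℝ ∞ P) ≤ 0 := fun X => by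
      have h0 := PricingProcedure.price_zero_eq_const h𝓕 hΦ X
      change (Φ.price (StopTime.zero_le (StopTime.infty 𝓕)) X : Lp ℝ ∞ P) ≤ 0 ↔ _
      rw [h0, ← Lp.coeFn_le]
      have hae : ∀ᵐ ω ∂P, (Lp.const ∞ P (Φ.initialPrice (X : Lp ℝ ∞ P)) : Lp ℝ ∞ P) ω
          = Φ.initialPrice (X : Lp ℝ ∞ P) ∧ (0 : Lp ℝ ∞ P) ω = 0 := by
        filter_upwards [Lp.coeFn_const (p := ∞) P (Φ.initialPrice (X : Lp ℝ ∞ P)),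
          Lp.coeFn_zero ℝ ∞ P] with ω h1 h2
        exact ⟨h1, h2⟩
      constructor
      · intro h
        obtain ⟨ω, h1, h2, h3⟩ := (h.and hae).exists
        rwa [h2, h3] at h1
      · intro h
        filter_upwards [hae] with ω h1
        rwa [h1.1, h1.2]
    intro Y
    constructor
    · rintro ⟨r, X, hr, hX, rfl⟩
      exact ⟨r, X, hr, (hle X).1 hX, rfl⟩
    · rintro ⟨r, X, hr, hX, rfl⟩
      exact ⟨r, ⟨X, mem_Linf_infty X⟩, hr, (hle ⟨X, mem_Linf_infty X⟩).2 hX, rfl⟩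
  -- A combination of `r • X` and `s • X'` is regrouped as one scalar times a convex combination of
  -- `X` and `X'`; a zero total weight is treated apart.
  have hconv : Convex ℝ Φ.zeroCostCone := by
    intro Y hY Y' hY' a b ha hb hab
    rw [hmem] at hY hY' ⊢
    obtain ⟨r, X, hr, hX, rfl⟩ := hY
    obtain ⟨s, X', hs, hX', rfl⟩ := hY'
    have h1 : 0 ≤ a * r := mul_nonneg ha hr
    have h2 : 0 ≤ b * s := mul_nonneg hb hs
    rcases (add_nonneg h1 h2).eq_or_lt with h0 | h0
    · refine ⟨0, 0, le_rfl, hρ.zero.le, ?_⟩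
      rw [smul_smul, smul_smul, show a * r = 0 by linarith, show b * s = 0 by linarith]
      simp
    · refine ⟨a * r + b * s, (a * r / (a * r + b * s)) • X + (1 - a * r / (a * r + b * s)) • X',
        h0.le, ?_, ?_⟩
      · have h3 : 0 ≤ a * r / (a * r + b * s) := div_nonneg h1 h0.le
        have h4 : a * r / (a * r + b * s) ≤ 1 := (div_le_one h0).2 (by linarith)
        refine (hρ.convex X X' _ h3 h4).trans ?_
        exact add_nonpos (mul_nonpos_of_nonneg_of_nonpos h3 hX)
          (mul_nonpos_of_nonneg_of_nonpos (by linarith) hX')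
      · have h5 : (a * r + b * s) * (a * r / (a * r + b * s)) = a * r := by field_simp
        have h6 : (a * r + b * s) * (1 - a * r / (a * r + b * s)) = b * s := by
          rw [mul_sub, h5]; ring
        rw [smul_add, smul_smul, smul_smul, smul_smul, smul_smul, h5, h6]
  obtain ⟨Q, hQ, hQP, hPQ, hQC⟩ := exists_equivalent_measure hconv
    (fun X hX => (hmem X).2 ⟨1, X, zero_le_one, (hρ.mono hX).trans hρ.zero.le, (one_smul _ _).symm⟩)
    (fun r hr Y hY => by
      rw [hmem] at hY ⊢
      obtain ⟨s, X, hs, hX, rfl⟩ := hY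
      exact ⟨r * s, X, mul_nonneg hr hs, hX, smul_smul _ _ _⟩) hNFL
  refine ⟨Q, hQ, hQP, hPQ, fun Y => ?_⟩
  -- Subtracting its price from `Y` leaves a position of cost zero.
  have h1 := hQC (Y + Lp.const ∞ P (-Φ.initialPrice Y)) ((hmem _).2
    ⟨1, _, zero_le_one, by rw [hρ.cash, add_neg_cancel], (one_smul _ _).symm⟩)
  have h2 : ∫ ω, (Y + Lp.const ∞ P (-Φ.initialPrice Y) : Lp ℝ ∞ P) ω ∂Q
      = (∫ ω, Y ω ∂Q) - Φ.initialPrice Y := by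
    have h3 : ∀ᵐ ω ∂Q, (Y + Lp.const ∞ P (-Φ.initialPrice Y) : Lp ℝ ∞ P) ω
        = Y ω + -Φ.initialPrice Y := hQP.ae_le (by
      filter_upwards [Lp.coeFn_add Y (Lp.const ∞ P (-Φ.initialPrice Y)),
        Lp.coeFn_const (p := ∞) P (-Φ.initialPrice Y)] with ω h1 h2
      rw [h1, Pi.add_apply, h2]; rfl)
    rw [integral_congr_ae h3, integral_add (Linfty_integrable_of_ac hQP Y) (integrable_const _)]
    simp [sub_eq_add_neg]
  linarith

/-- The initial ask price is dominated by the super-replication price. -/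
theorem initialPrice_le_of_forall_ELMM (h𝓕 : UsualConditions 𝓕 P) (hΦ : Φ.IsTCPP)
    (hNFL : Φ.NoFreeLunch) (hext : Φ.ExtendsDynamics S) {X : Lp ℝ ∞ P} {b : ℝ}
    (hb : ∀ Q ∈ ELMM 𝓕 P S, ∫ ω, X ω ∂Q ≤ b) : Φ.initialPrice X ≤ b := by
  obtain ⟨Q₀, hQ₀, hQ₀P, hPQ₀, hQ₀ρ⟩ := exists_measure_integral_le_initialPrice h𝓕 hΦ hNFL
  have hρ := PricingProcedure.isConvexPrice_initialPrice h𝓕 hΦ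
  refine le_of_forall_pos_le_add fun ε hε => ?_
  obtain ⟨Q, hQ, hQP, hQρ⟩ := hρ.exists_measure X hε
  -- A bound for the penalty of `Q`. The mixtures below have penalty at most `(1 - t) * c ≤ c`,
  -- which is where `0 ≤ c` is needed.
  set c := (∫ ω, X ω ∂Q) - Φ.initialPrice X + ε with hc
  have hc0 : 0 ≤ c := by
    have h1 := hQρ 0
    have h2 : ∫ ω, (0 : Lp ℝ ∞ P) ω ∂Q = 0 := by
      rw [integral_congr_ae (hQP.ae_le (Lp.coeFn_zero ℝ ∞ P))]
      simp
    rw [h2, hρ.zero] at h1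
    linarith
  have hmix : ∀ t : ℝ, 0 < t → t < 1 →
      (1 - t) * (∫ ω, X ω ∂Q) + t * (∫ ω, X ω ∂Q₀) ≤ b := by
    intro t ht0 ht1
    set N : Measure Ω := ENNReal.ofReal (1 - t) • Q + ENNReal.ofReal t • Q₀ with hN
    have hNint : ∀ Y : Lp ℝ ∞ P,
        ∫ ω, Y ω ∂N = (1 - t) * (∫ ω, Y ω ∂Q) + t * (∫ ω, Y ω ∂Q₀) := fun Y => by
      rw [hN, integral_add_measure
        ((Linfty_integrable_of_ac hQP Y).smul_measure ENNReal.ofReal_ne_top)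
        ((Linfty_integrable_of_ac hQ₀P Y).smul_measure ENNReal.ofReal_ne_top),
        integral_smul_measure, integral_smul_measure, ENNReal.toReal_ofReal (by linarith),
        ENNReal.toReal_ofReal ht0.le, smul_eq_mul, smul_eq_mul]
    have hNprob : IsProbabilityMeasure N := ⟨by
      rw [hN, Measure.add_apply, Measure.smul_apply, Measure.smul_apply, measure_univ,
        measure_univ, smul_eq_mul, smul_eq_mul, mul_one, mul_one,
        ← ENNReal.ofReal_add (by linarith) ht0.le]
      simp⟩
    have hNP : N ≪ P := Measure.AbsolutelyContinuous.add_left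
      (hQP.smul_left _) (hQ₀P.smul_left _)
    have hPR : P ≪ N := by
      intro A hA
      rw [hN, Measure.add_apply, add_eq_zero, Measure.smul_apply, Measure.smul_apply,
        smul_eq_mul, smul_eq_mul, mul_eq_zero, mul_eq_zero] at hA
      exact hPQ₀ (hA.2.resolve_left (ENNReal.ofReal_pos.2 ht0).ne')
    rw [← hNint]
    refine hb N (mem_ELMM_of_integral_le h𝓕 hΦ hext hNP hPR (c := c) fun Y => ?_)
    rw [hNint]
    have h1 := mul_le_mul_of_nonneg_left (hQρ Y) (show 0 ≤ 1 - t by linarith)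
    have h2 := mul_le_mul_of_nonneg_left (hQ₀ρ Y) ht0.le
    have h3 := mul_nonneg ht0.le hc0
    nlinarith
  have hQb : ∫ ω, X ω ∂Q ≤ b := by
    have h1 : Tendsto (fun t : ℝ => (1 - t) * (∫ ω, X ω ∂Q) + t * (∫ ω, X ω ∂Q₀)) (𝓝[>] 0)
        (𝓝 ((1 - 0) * (∫ ω, X ω ∂Q) + 0 * (∫ ω, X ω ∂Q₀))) :=
      (Continuous.tendsto (by fun_prop) 0).mono_left nhdsWithin_le_nhds
    have h2 := le_of_tendsto h1 (b := b) (by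
      filter_upwards [Ioo_mem_nhdsGT (show (0 : ℝ) < 1 by norm_num)] with t ht
      exact hmix t ht.1 ht.2)
    simpa using h2
  linarith

theorem exists_mem_ELMM (h𝓕 : UsualConditions 𝓕 P) (hΦ : Φ.IsTCPP)
    (hNFL : Φ.NoFreeLunch) (hext : Φ.ExtendsDynamics S) : ∃ Q ∈ ELMM 𝓕 P S,
      ∀ Y : Lp ℝ ∞ P, ∫ ω, Y ω ∂Q ≤ Φ.initialPrice Y := by
  obtain ⟨Q, hQ, hQP, hPQ, hQρ⟩ := exists_measure_integral_le_initialPrice h𝓕 hΦ hNFL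
  exact ⟨Q, mem_ELMM_of_integral_le h𝓕 hΦ hext hQP hPQ (c := 0) fun Y => by
    rw [add_zero]; exact hQρ Y, hQρ⟩

/-- The essential supremum of the conditional prices. -/
theorem exists_isLUB_condPrices (hne : (ELMM 𝓕 P S).Nonempty) (σ : StopTime 𝓕) (X : Lp ℝ ∞ P) :
    ∃ U : Linf P σ, IsLUB (condPrices P S σ X) (U : Lp ℝ ∞ P) := by
  obtain ⟨M, hM0, hM⟩ := Linfty_exists_bound X
  have hbd : ∀ Z ∈ condPrices P S σ X, ∀ᵐ ω ∂P, |Z ω| ≤ M := by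
    rintro Z ⟨Q, ⟨hQ, hQP, hPQ, -⟩, hZ⟩
    filter_upwards [hZ, abs_condExp_le hQP hPQ σ hM] with ω h1 h2
    rwa [h1]
  have hnonempty : (condPrices P S σ X).Nonempty := by
    obtain ⟨Q, hQmem⟩ := hne
    obtain ⟨hQ, hQP, hPQ, -⟩ := id hQmem
    obtain ⟨Z, hZ⟩ := exists_Linf_ae_eq σ (P := P)
      (stronglyMeasurable_condExp (m := σ.sigma) (μ := Q) (f := X)).aestronglyMeasurable
      (abs_condExp_le hQP hPQ σ hM)
    exact ⟨Z, Q, hQmem, hZ⟩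
  obtain ⟨Y, hY, hYsup⟩ := exists_seq_ae_le_iSup hnonempty hbd
  have hYM : ∀ᵐ ω ∂P, ∀ n, |Y n ω| ≤ M := ae_all_iff.2 fun n => hbd _ (hY n)
  choose Q hQ hYQ using hY
  have hYQ' : ∀ᵐ ω ∂P, ∀ n, Y n ω = condExp σ.sigma (Q n) X ω := ae_all_iff.2 hYQ
  -- A countable supremum of `𝓕_σ`-measurable versions places `U` in `L^∞(𝓕_σ)`, so that it can be
  -- used as a translation at time `σ`.
  have hmeas : StronglyMeasurable[σ.sigma] fun ω => ⨆ n, condExp σ.sigma (Q n) X ω := by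
    have h1 : Measurable[σ.sigma] fun ω => ⨆ n, condExp σ.sigma (Q n) X ω :=
      Measurable.iSup fun n => stronglyMeasurable_condExp.measurable
    exact h1.stronglyMeasurable
  obtain ⟨U, hU⟩ := exists_Linf_ae_eq σ (P := P) hmeas.aestronglyMeasurable (C := M) (by
    filter_upwards [hYM, hYQ'] with ω h1 h2
    simp only [← h2]
    refine abs_le.2 ⟨(abs_le.1 (h1 0)).1.trans (le_ciSup (f := fun n => Y n ω) ?_ 0),
      ciSup_le fun n => (abs_le.1 (h1 n)).2⟩
    exact ⟨M, by rintro _ ⟨n, rfl⟩; exact (abs_le.1 (h1 n)).2⟩)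
  have hUY : ∀ᵐ ω ∂P, (U : Lp ℝ ∞ P) ω = ⨆ n, Y n ω := by
    filter_upwards [hU, hYQ'] with ω h1 h2
    simp only [h2, h1]
  refine ⟨U, fun Z hZ => ?_, fun V hV => ?_⟩
  · rw [← Lp.coeFn_le]
    filter_upwards [hYsup Z hZ, hUY] with ω h1 h2
    rwa [h2]
  · rw [← Lp.coeFn_le]
    filter_upwards [hUY, ae_all_iff.2 fun n =>
      (Lp.coeFn_le _ _).2 (hV (show Y n ∈ condPrices P S σ X from ⟨Q n, hQ n, hYQ n⟩))] with ω h1 h2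
    rw [h1]
    exact ciSup_le h2

/-- The ask price is dominated by every `𝓕_σ`-measurable upper bound of the conditional
expectations under the local martingale measures. -/
theorem price_le_of_mem_upperBounds (h𝓕 : UsualConditions 𝓕 P) (hΦ : Φ.IsTCPP)
    (hNFL : Φ.NoFreeLunch) (hext : Φ.ExtendsDynamics S) {σ τ : StopTime 𝓕} (h : σ ≤ τ)
    {X : Linf P τ} {U : Linf P σ}
    (hU : (U : Lp ℝ ∞ P) ∈ upperBounds (condPrices P S σ (X : Lp ℝ ∞ P))) :
    (Φ.price h X : Lp ℝ ∞ P) ≤ (U : Lp ℝ ∞ P) := by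
  obtain ⟨u, hu, hUu⟩ := lpMeas.aestronglyMeasurable U
  obtain ⟨p, hp, hXp⟩ := lpMeas.aestronglyMeasurable (Φ.price h X)
  set A : Set Ω := {ω | u ω < p ω} with hAdef
  have hA : MeasurableSet[σ.sigma] A := by
    have h1 : A = (fun ω => p ω - u ω) ⁻¹' Set.Ioi 0 := by
      ext ω
      simp [hAdef, sub_pos]
    rw [h1]
    exact (hp.sub hu).measurable measurableSet_Ioi
  obtain ⟨W, hW'⟩ := exists_Linf_indicator_sub h hA X U
  have hneg : Φ.initialPrice (W : Lp ℝ ∞ P) ≤ 0 := by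
    refine initialPrice_le_of_forall_ELMM h𝓕 hΦ hNFL hext fun Q hQmem => ?_
    obtain ⟨hQ, hQP, hPQ, -⟩ := id hQmem
    obtain ⟨K, hK0, hK⟩ := Linfty_exists_bound (X : Lp ℝ ∞ P)
    obtain ⟨Z, hZ⟩ := exists_Linf_ae_eq σ (P := P)
      (stronglyMeasurable_condExp (m := σ.sigma) (μ := Q)
        (f := ((X : Lp ℝ ∞ P) : Ω → ℝ))).aestronglyMeasurable
      (abs_condExp_le hQP hPQ σ hK)
    have hZU := (Lp.coeFn_le _ _).2 (hU ⟨Q, hQmem, hZ⟩)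
    have hXint : Integrable (X : Lp ℝ ∞ P) Q := Linfty_integrable_of_ac hQP _
    have hUint : Integrable (U : Lp ℝ ∞ P) Q := Linfty_integrable_of_ac hQP _
    rw [integral_congr_ae (hQP.ae_le hW'), integral_indicator (σ.sigma_le A hA),
      integral_sub hXint.integrableOn hUint.integrableOn, sub_nonpos,
      ← setIntegral_condExp σ.sigma_le hXint hA]
    refine setIntegral_mono_ae integrable_condExp.integrableOn hUint.integrableOn ?_
    refine hQP.ae_le ?_
    filter_upwards [hZ, hZU] with ω h1 h2
    rwa [← h1]
  have hpW : (Φ.price h W : Lp ℝ ∞ P) =ᵐ[P]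
      fun ω => max ((Φ.price h X : Lp ℝ ∞ P) ω - (U : Lp ℝ ∞ P) ω) 0 := by
    filter_upwards [PricingProcedure.price_indicator_sub Φ h hA hW', hUu, hXp] with ω h1 h2 h3
    rw [h1]
    by_cases hω : ω ∈ A
    · rw [Set.indicator_of_mem hω, max_eq_left]
      rw [h2, h3]
      exact (sub_pos.2 hω).le
    · rw [Set.indicator_of_notMem hω, max_eq_right]
      rw [h2, h3]
      exact sub_nonpos.2 (not_lt.1 hω)
  obtain ⟨Q, ⟨hQ, hQP, hPQ, -⟩, hQρ⟩ := exists_mem_ELMM (S := S) h𝓕 hΦ hNFL hext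
  -- Time consistency transfers the sign of the initial price of `W` to its price at `σ`. The latter
  -- is nonnegative with nonpositive `Q`-expectation, hence vanishes.
  have h1 := (hQρ (Φ.price h W : Lp ℝ ∞ P)).trans
    ((PricingProcedure.initialPrice_price hΦ h W).trans_le hneg)
  have hnn : ∀ᵐ ω ∂Q, 0 ≤ (Φ.price h W : Lp ℝ ∞ P) ω := hQP.ae_le (by
    filter_upwards [hpW] with ω h2
    rw [h2]; exact le_max_right _ _)
  have h2 := (integral_eq_zero_iff_of_nonneg_ae hnn (Linfty_integrable_of_ac hQP _)).1
    (le_antisymm h1 (integral_nonneg_of_ae hnn))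
  rw [← Lp.coeFn_le]
  filter_upwards [hPQ.ae_le h2, hpW] with ω h3 h4
  rw [h4] at h3
  exact sub_nonpos.1 (max_eq_right_iff.1 h3)

end MartingaleMeasures

end BidAsk

/-! ### The conditional bounds and the bounds at time `0`. -/

theorem mainTheorem8 {Ω : Type*} {m : MeasurableSpace Ω} (P : Measure Ω) [IsProbabilityMeasure P]
    (𝓕 : Filtration ℝ≥0 m) (h𝓕 : BidAsk.UsualConditions 𝓕 P)
    {d : ℕ} (S : Fin (d + 1) → ℝ≥0 → Ω → ℝ) (hS : BidAsk.IsMarket 𝓕 P S)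
    (Pi : BidAsk.PricingProcedure 𝓕 P) (hPi : Pi.IsTCPP) (hNFL : Pi.NoFreeLunch)
    (hext : Pi.ExtendsDynamics S) :
    -- at any stopping time `σ ≤ τ`: the conditional bounds, almost surely
    (∀ (σ τ : BidAsk.StopTime 𝓕) (h : σ ≤ τ) (X : BidAsk.Linf P τ),
      ∃ L U : Lp ℝ ∞ P,
        IsGLB (BidAsk.condPrices P S σ (X : Lp ℝ ∞ P)) L ∧
        IsLUB (BidAsk.condPrices P S σ (X : Lp ℝ ∞ P)) U ∧
        L ≤ -(Pi.price h (-X) : Lp ℝ ∞ P) ∧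
        -(Pi.price h (-X) : Lp ℝ ∞ P) ≤ (Pi.price h X : Lp ℝ ∞ P) ∧
        (Pi.price h X : Lp ℝ ∞ P) ≤ U) ∧
    -- at time `0`: the sub- and super-replication prices
    (∀ (τ : BidAsk.StopTime 𝓕) (X : BidAsk.Linf P τ),
      ∃ l u : ℝ,
        IsGLB ((fun Q : Measure Ω => ∫ ω, (X : Lp ℝ ∞ P) ω ∂Q) '' BidAsk.ELMM 𝓕 P S) l ∧
        IsLUB ((fun Q : Measure Ω => ∫ ω, (X : Lp ℝ ∞ P) ω ∂Q) '' BidAsk.ELMM 𝓕 P S) u ∧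
        ∀ᵐ ω ∂P,
          l ≤ -(Pi.price (BidAsk.StopTime.zero_le τ) (-X) : Lp ℝ ∞ P) ω ∧
          -(Pi.price (BidAsk.StopTime.zero_le τ) (-X) : Lp ℝ ∞ P) ω
            ≤ (Pi.price (BidAsk.StopTime.zero_le τ) X : Lp ℝ ∞ P) ω ∧
          (Pi.price (BidAsk.StopTime.zero_le τ) X : Lp ℝ ∞ P) ω ≤ u) := by
  obtain ⟨Q₀, hQ₀, -⟩ := BidAsk.exists_mem_ELMM (S := S) h𝓕 hPi hNFL hext
  refine ⟨fun σ τ h X => ?_, fun τ X => ?_⟩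
  · obtain ⟨U, hU⟩ := BidAsk.exists_isLUB_condPrices ⟨Q₀, hQ₀⟩ σ (X : Lp ℝ ∞ P)
    -- The lower bound is minus the essential supremum for `-X`.
    obtain ⟨V, hV⟩ := BidAsk.exists_isLUB_condPrices ⟨Q₀, hQ₀⟩ σ (-X : Lp ℝ ∞ P)
    refine ⟨-V, U, ?_, hU, ?_, Pi.bid_le_ask h X,
      BidAsk.price_le_of_mem_upperBounds h𝓕 hPi hNFL hext h hU.1⟩
    · rw [BidAsk.condPrices_neg] at hV
      have := hV.neg
      rwa [neg_neg] at this
    · exact neg_le_neg (BidAsk.price_le_of_mem_upperBounds h𝓕 hPi hNFL hext h (X := -X) hV.1)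
  · obtain ⟨M, -, hM⟩ := BidAsk.Linfty_exists_bound (X : Lp ℝ ∞ P)
    set T := (fun Q : Measure Ω => ∫ ω, (X : Lp ℝ ∞ P) ω ∂Q) '' BidAsk.ELMM 𝓕 P S with hT
    have hne : T.Nonempty := ⟨_, Q₀, hQ₀, rfl⟩
    have hTM : ∀ x ∈ T, |x| ≤ M := by
      rintro _ ⟨Q, ⟨hQ, hQP, -⟩, rfl⟩
      have := norm_integral_le_of_norm_le_const (f := ((X : Lp ℝ ∞ P) : Ω → ℝ)) (hQP.ae_le hM)
      simpa using this
    have hglb := isGLB_csInf hne ⟨-M, fun x hx => (abs_le.1 (hTM x hx)).1⟩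
    have hlub := isLUB_csSup hne ⟨M, fun x hx => (abs_le.1 (hTM x hx)).2⟩
    refine ⟨sInf T, sSup T, hglb, hlub, ?_⟩
    -- At time `0` the unconditional domination applies directly, without the conditional bound.
    have hask : Pi.initialPrice (X : Lp ℝ ∞ P) ≤ sSup T :=
      BidAsk.initialPrice_le_of_forall_ELMM h𝓕 hPi hNFL hext fun Q hQ => hlub.1 ⟨Q, hQ, rfl⟩
    have hbid : Pi.initialPrice (-X : Lp ℝ ∞ P) ≤ -sInf T :=
      BidAsk.initialPrice_le_of_forall_ELMM h𝓕 hPi hNFL hext fun Q hQ => by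
        have h1 := hglb.1 ⟨Q, hQ, rfl⟩
        rw [integral_congr_ae (hQ.2.1.ae_le (Lp.coeFn_neg (X : Lp ℝ ∞ P)))]
        simp only [_root_.Pi.neg_apply]
        rw [integral_neg]
        exact neg_le_neg h1
    have h1 := BidAsk.PricingProcedure.price_zero_eq_const h𝓕 hPi X
    have h2 := BidAsk.PricingProcedure.price_zero_eq_const h𝓕 hPi (-X)
    have h3 := (Lp.coeFn_le _ _).2 (Pi.bid_le_ask (BidAsk.StopTime.zero_le τ) X)
    filter_upwards [h3, Lp.coeFn_neg (Pi.price (BidAsk.StopTime.zero_le τ) (-X) : Lp ℝ ∞ P),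
      Lp.coeFn_const (p := ∞) P (Pi.initialPrice (X : Lp ℝ ∞ P)),
      Lp.coeFn_const (p := ∞) P (Pi.initialPrice (-X : Lp ℝ ∞ P))] with ω a1 a2 a3 a4
    rw [a2, _root_.Pi.neg_apply] at a1
    refine ⟨?_, a1, ?_⟩
    · rw [h2]
      change _ ≤ -(Lp.const ∞ P (Pi.initialPrice (-X : Lp ℝ ∞ P)) : Lp ℝ ∞ P) ω
      rw [a4]
      exact le_neg.1 hbid
    · rw [h1, a3]
      exact hask
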